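/- Let $\Omega=\Omega_{\mathbb{C}^2}(2,2,2)$ be the space of polynomial mappings $F=(f_1,f_2,f_3):\mathbb{C}^2\to\mathbb{C}^3$ with $\deg f_i\le 2$ for $i=1,2,3$, identified with $\mathbb{C}^{18}$ through the coefficients. A singular point of $F$ is a point of $\mathbb{C}^2$ at which all three $2\times 2$ minors of the Jacobian matrix of $F$ vanish. Let $O(F)=\{L\circ F\circ R\}\subset\Omega$, where $L$ and $R$ run over the affine automorphisms of $\mathbb{C}^3$ and $\mathbb{C}^2$, respectively; $F$ is linearly equivalent to $G$ if $F\in O(G)$. Put $F_1=(x^2+y,\;y^2+x,\;xy)$. For every $F\in\Omega$ the following conditions are equivalent: 1. $F$ has exactly three singular points; 2. $O(F)$ is an open dense subset of $\Omega$ (in the Zariski topology or, equivalently, in the Euclidean topology); 3. $O(F)=O(F_1)$, i.e. $F$ is linearly equivalent to $F_1$. Moreover, for such $F$ one has $\mu(F)=1$, i.e. for all $x$ in some nonempty Zariski open subset of $\mathbb{C}^2$ the set $F^{-1}(F(x))$ has exactly one point; the self-intersection curve $$SI_F=\{x\in\mathbb{C}^2:\ \text{the scheme-theoretic fibre } F^{-1}(F(x))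 \text{ is not a single reduced point}\}$$ is a union of three lines in general position (any two of them meet in exactly one point, and the three have no common point); and $\dim O(F)=18$. -/

import Mathlib

open MvPolynomial
open scoped Topology

noncomputable section

namespace QuadMaps

/-- Polynomial mappings `F = (f₁, f₂, f₃) : ℂ² → ℂ³` with `deg fᵢ ≤ 2` for all `i`. -/
abbrev Omega : Type := Fin 3 → restrictTotalDegree (Fin 2) ℂ 2

/-- The mapping `ℂ² → ℂ³` given by an element of `Omega`. -/
def toMap (F : Omega) (p : Fin 2 → ℂ) : Fin 3 → ℂ := fun i => eval p (F i).1

/-- The minor `∂f/∂x · ∂g/∂y - ∂f/∂y · ∂g/∂x`. -/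
def jac (f g : MvPolynomial (Fin 2) ℂ) : MvPolynomial (Fin 2) ℂ :=
  pderiv 0 f * pderiv 1 g - pderiv 1 f * pderiv 0 g

/-- The critical set: the singular points of `F`. -/
def criticalSet (F : Omega) : Set (Fin 2 → ℂ) :=
  {p | eval p (jac (F 1).1 (F 2).1) = 0 ∧ eval p (jac (F 2).1 (F 0).1) = 0 ∧
    eval p (jac (F 0).1 (F 1).1) = 0}

/-- The orbit of `F` under `(L, R) F = L ∘ F ∘ R`, with `L` and `R` affine automorphisms
of `ℂ³` and `ℂ²`. -/
def orbit (F : Omega) : Set Omega :=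
  {G | ∃ (L : (Fin 3 → ℂ) ≃ᵃ[ℂ] (Fin 3 → ℂ)) (R : (Fin 2 → ℂ) ≃ᵃ[ℂ] (Fin 2 → ℂ)),
    toMap G = L ∘ toMap F ∘ R}

/-- `F` is linearly equivalent to `G`. -/
def LinearlyEquivalent (F G : Omega) : Prop := F ∈ orbit G

/-- The mapping `(x² + y, y² + x, x y)`. -/
def F₁ : Omega :=
  ![⟨X 0 ^ 2 + X 1, by
      rw [mem_restrictTotalDegree]
      refine (totalDegree_add _ _).trans (max_le ?_ ?_)
      · simp [totalDegree_X_pow]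
      · simp [totalDegree_X]⟩,
    ⟨X 1 ^ 2 + X 0, by
      rw [mem_restrictTotalDegree]
      refine (totalDegree_add _ _).trans (max_le ?_ ?_)
      · simp [totalDegree_X_pow]
      · simp [totalDegree_X]⟩,
    ⟨X 0 * X 1, by
      rw [mem_restrictTotalDegree]
      refine (totalDegree_mul _ _).trans ?_
      simp [totalDegree_X]⟩]

/-- The exponents of the monomials `1, x, y, x², xy, y²`. -/
def expo (j : Fin 6) : Fin 2 →₀ ℕ :=
  Finsupp.equivFunOnFinite.symm
    ((![![0, 0], ![1, 0], ![0, 1], ![2, 0], ![1, 1], ![0, 2]] : Fin 6 → Fin 2 → ℕ) j)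

/-- The coefficients of `F`, which identify `Omega` with `ℂ¹⁸`. -/
def coeffs (F : Omega) : Fin 3 × Fin 6 → ℂ := fun k => coeff (expo k.2) (F k.1).1

/-- The Zariski topology on the affine space `ℂ^σ`, induced from the prime spectrum of the
polynomial ring; the closed sets are the common zero sets of families of polynomials. -/
abbrev zariskiAffine (σ : Type) : TopologicalSpace (σ → ℂ) :=
  TopologicalSpace.induced (fun x => (pointToPoint x : PrimeSpectrum (MvPolynomial σ ℂ)))
    PrimeSpectrum.zariskiTopology

/-- The Zariski topology on `Omega ≅ ℂ¹⁸`. -/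
abbrev zariski : TopologicalSpace Omega :=
  TopologicalSpace.induced coeffs (zariskiAffine (Fin 3 × Fin 6))

/-- The Euclidean topology on `Omega ≅ ℂ¹⁸`. -/
abbrev euclidean : TopologicalSpace Omega :=
  TopologicalSpace.induced coeffs Pi.topologicalSpace

/-- `S` is open and dense for the topology `t`. -/
def IsOpenDense {T : Type} (t : TopologicalSpace T) (S : Set T) : Prop :=
  IsOpen[t] S ∧ @Dense T t S

/-- The dimension of a subset of `Omega`: its Krull dimension as a topological space with the
Zariski topology. -/
def dim (S : Set Omega) : WithBot ℕ∞ :=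
  @topologicalKrullDim S (TopologicalSpace.induced Subtype.val zariski)

/-- The topological degree `μ(F)` is `d`: the set `F⁻¹(F(x))` has `d` points for generic `x`. -/
def HasTopologicalDegree (F : Omega) (d : ℕ) : Prop :=
  ∃ U : Set (Fin 2 → ℂ), IsOpen[zariskiAffine (Fin 2)] U ∧ U.Nonempty ∧
    ∀ x ∈ U, (toMap F ⁻¹' {toMap F x}).encard = d

/-- The ideal of the scheme-theoretic fibre `F⁻¹(F(p))`. -/
def fibreIdeal (F : Omega) (p : Fin 2 → ℂ) : Ideal (MvPolynomial (Fin 2) ℂ) :=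
  Ideal.span (Set.range fun i => (F i).1 - C (toMap F p i))

/-- The scheme `F⁻¹(F(p))` is a simple point: its coordinate ring is `ℂ`. -/
def FibreIsSimplePoint (F : Omega) (p : Fin 2 → ℂ) : Prop :=
  Function.Bijective (algebraMap ℂ (MvPolynomial (Fin 2) ℂ ⧸ fibreIdeal F p))

/-- The self-intersection curve. -/
def SI (F : Omega) : Set (Fin 2 → ℂ) := {p | ¬ FibreIsSimplePoint F p}

/-- An affine line in `ℂ²`. -/
def IsLine (l : AffineSubspace ℂ (Fin 2 → ℂ)) : Prop :=
  (l : Set (Fin 2 → ℂ)).Nonempty ∧ Module.finrank ℂ l.direction = 1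

/-- `S` is a union of three lines in general position: any two of them meet in exactly one
point, and the three have no common point. -/
def IsThreeLinesInGeneralPosition (S : Set (Fin 2 → ℂ)) : Prop :=
  ∃ l : Fin 3 → AffineSubspace ℂ (Fin 2 → ℂ),
    (∀ i, IsLine (l i)) ∧
    S = ⋃ i, (l i : Set (Fin 2 → ℂ)) ∧
    (∀ i j, i ≠ j → ∃! p, p ∈ l i ∧ p ∈ l j) ∧
    ¬ ∃ p, ∀ i, p ∈ l i

end QuadMaps

end

open MvPolynomial
open scoped Topology

noncomputable section

namespace QuadMaps

/-! Write `c_j` for the vector in `ℂ³` of the coefficients of the `j`-th monomial. The differential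
of a quadratic mapping is affine in the point `p`, and `v` lies in its kernel at `p` when `2p₀v₀ c₃
+ (p₀v₁ + p₁v₀) c₄ + 2p₁v₁ c₅ + v₀ c₁ + v₁ c₂ = 0` (`IsKer`). If `D = det(c₃, c₄, c₅) ≠ 0`, Cramer's
rule turns this into three scalar equations, and eliminating `p` leaves a binary cubic form in `v`.
Each of its roots determines a unique singular point, and distinct projective roots give distinct
points unless the form is identically zero, in which case there is at most one singular point. If `D
= 0`, some nontrivial combination of the components is affine; with three singular points it would
be constant, and the singular set would be an empty or infinite conic. Hence three singular points
means that `D` times the discriminant of the cubic does not vanish (`encard_crit_eq_three_iff`), a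
nonempty principal open condition on the coefficients.

Three singular points and their kernel directions furnish an affine frame in which the mapping
becomes `(x², y², (1 - x - y)²)` up to an affine automorphism of the target (`exists_eq_normalMap`).
So all such mappings form a single orbit, that of `F₁`, which is open and dense in both topologies;
any other open dense orbit would meet it and so coincide with it.

The normal form squares the barycentric coordinates `a + b + c = 1`. A fibre consists of the sign
changes that preserve this sum, so it is a simple point unless a pair of coordinates sums to zero,
that is, unless the remaining one equals 1. This gives degree one and the three lines. The dimension
is 18 because a nonempty principal open subset of affine space contains full chains of coordinate
slices. -/

/-- The quadratic mapping with the given coefficients of `1, x, y, x², xy, y²`. -/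
def quadMap (c : Fin 3 × Fin 6 → ℂ) (p : Fin 2 → ℂ) : Fin 3 → ℂ := fun i =>
  c (i, 0) + c (i, 1) * p 0 + c (i, 2) * p 1 + c (i, 3) * p 0 ^ 2 + c (i, 4) * (p 0 * p 1) +
    c (i, 5) * p 1 ^ 2

/-! ### Coefficients as coordinates on the space of quadratic mappings -/

lemma expo_apply_zero (j : Fin 6) : expo j 0 = (![0, 1, 0, 2, 1, 0] : Fin 6 → ℕ) j := by
  fin_cases j <;> rfl

lemma expo_apply_one (j : Fin 6) : expo j 1 = (![0, 0, 1, 0, 1, 2] : Fin 6 → ℕ) j := by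
  fin_cases j <;> rfl

lemma expo_injective : Function.Injective expo := by
  intro i j h
  have h0 := DFunLike.congr_fun h 0
  have h1 := DFunLike.congr_fun h 1
  rw [expo_apply_zero, expo_apply_zero] at h0
  rw [expo_apply_one, expo_apply_one] at h1
  clear h
  revert i j
  decide

lemma exists_expo_eq (m : Fin 2 →₀ ℕ) (hm : m 0 + m 1 ≤ 2) : ∃ j, expo j = m := by
  have key : ∀ a b : ℕ, a ≤ 2 → b ≤ 2 → a + b ≤ 2 → ∃ j : Fin 6,
      (![0, 1, 0, 2, 1, 0] : Fin 6 → ℕ) j = a ∧ (![0, 0, 1, 0, 1, 2] : Fin 6 → ℕ) j = b := by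
    intro a b ha hb
    interval_cases a <;> interval_cases b <;> decide
  obtain ⟨j, h0, h1⟩ := key (m 0) (m 1) (by omega) (by omega) hm
  refine ⟨j, Finsupp.ext fun i => ?_⟩
  fin_cases i
  · exact (expo_apply_zero j).trans h0
  · exact (expo_apply_one j).trans h1

lemma degree_fin_two (m : Fin 2 →₀ ℕ) : (m.sum fun _ e => e) = m 0 + m 1 := by
  rw [Finsupp.sum_fintype _ _ (fun _ => rfl), Fin.sum_univ_two]

lemma monomial_expo (j : Fin 6) (a : ℂ) :
    monomial (expo j) a = C a * (X 0 ^ expo j 0 * X 1 ^ expo j 1) := by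
  rw [monomial_eq, Finsupp.prod_fintype _ _ (fun _ => pow_zero _), Fin.prod_univ_two]

/-- A polynomial of degree at most two is determined by six coefficients. -/
lemma eq_sum_monomial_expo (f : MvPolynomial (Fin 2) ℂ) (hf : f.totalDegree ≤ 2) :
    f = ∑ j, monomial (expo j) (coeff (expo j) f) := by
  classical
  ext m
  rw [coeff_sum]
  simp only [coeff_monomial]
  by_cases hm : m 0 + m 1 ≤ 2
  · obtain ⟨j, rfl⟩ := exists_expo_eq m hm
    simp [expo_injective.eq_iff]
  · rw [Finset.sum_eq_zero]
    · by_contra h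
      have := le_totalDegree (mem_support_iff.2 h)
      rw [degree_fin_two] at this
      omega
    · intro j _
      rw [if_neg]
      rintro rfl
      apply hm
      rw [expo_apply_zero, expo_apply_one]
      fin_cases j <;> decide

lemma val_eq (F : Omega) (i : Fin 3) :
    (F i).1 = C (coeffs F (i, 0)) + C (coeffs F (i, 1)) * X 0 + C (coeffs F (i, 2)) * X 1 +
      C (coeffs F (i, 3)) * X 0 ^ 2 + C (coeffs F (i, 4)) * (X 0 * X 1) +
      C (coeffs F (i, 5)) * X 1 ^ 2 := by
  have h := eq_sum_monomial_expo (F i).1 ((mem_restrictTotalDegree _ _ _).1 (F i).2)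
  rw [h]
  simp [Fin.sum_univ_six, monomial_expo, expo_apply_zero, expo_apply_one, coeffs]

lemma toMap_eq_quadMap (F : Omega) : toMap F = quadMap (coeffs F) := by
  funext p i
  simp [toMap, quadMap, val_eq F i]

lemma coeffs_injective : Function.Injective coeffs := by
  intro F G h
  funext i
  apply Subtype.ext
  rw [val_eq F i, val_eq G i, h]

lemma coeffs_surjective : Function.Surjective coeffs := by
  intro c
  have hd : ∀ i, (∑ j, monomial (expo j) (c (i, j))) ∈ restrictTotalDegree (Fin 2) ℂ 2 := by
    intro i
    refine Submodule.sum_mem _ fun j _ => ?_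
    rw [mem_restrictTotalDegree]
    refine (totalDegree_monomial_le _ _).trans ?_
    change ((expo j).sum fun _ e => e) ≤ 2
    rw [degree_fin_two, expo_apply_zero, expo_apply_one]
    fin_cases j <;> decide
  refine ⟨fun i => ⟨_, hd i⟩, ?_⟩
  classical
  funext ⟨i, j⟩
  simp [coeffs, coeff_sum, coeff_monomial, expo_injective.eq_iff]

/-! ### Singular points and kernel directions -/

/-- The points at which a mapping is symmetric in some direction. For a quadratic mapping these
are the points at which the differential is not injective. -/
def crit (f : (Fin 2 → ℂ) → Fin 3 → ℂ) : Set (Fin 2 → ℂ) :=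
  {p | ∃ v, v ≠ 0 ∧ f (p + v) = f (p - v)}

/-- The vector `v` lies in the kernel of the differential of `quadMap c` at `p`. -/
def IsKer (c : Fin 3 × Fin 6 → ℂ) (p v : Fin 2 → ℂ) : Prop :=
  ∀ i, 2 * (p 0 * v 0) * c (i, 3) + (p 0 * v 1 + p 1 * v 0) * c (i, 4) +
    2 * (p 1 * v 1) * c (i, 5) + v 0 * c (i, 1) + v 1 * c (i, 2) = 0

/-- The even part of a quadratic mapping about `p` cancels, so the difference of the two values is
exactly twice the differential at `p` applied to `v`. -/
lemma quadMap_add_eq_sub_iff (c : Fin 3 × Fin 6 → ℂ) (p v : Fin 2 → ℂ) :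
    quadMap c (p + v) = quadMap c (p - v) ↔ IsKer c p v := by
  rw [funext_iff]
  refine forall_congr' fun i => ?_
  simp only [quadMap, Pi.add_apply, Pi.sub_apply]
  constructor
  · intro h
    linear_combination h / 2
  · intro h
    linear_combination 2 * h

lemma mem_crit_quadMap {c : Fin 3 × Fin 6 → ℂ} {p : Fin 2 → ℂ} :
    p ∈ crit (quadMap c) ↔ ∃ v, v ≠ 0 ∧ IsKer c p v :=
  exists_congr fun v => and_congr_right fun _ => quadMap_add_eq_sub_iff c p v

/-- Two vectors are parallel if and only if their cross product vanishes. -/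
lemma exists_combination_eq_zero_iff (g h : Fin 3 → ℂ) :
    (∃ v : Fin 2 → ℂ, v ≠ 0 ∧ ∀ i, v 0 * g i + v 1 * h i = 0) ↔
      g 1 * h 2 - h 1 * g 2 = 0 ∧ g 2 * h 0 - h 2 * g 0 = 0 ∧ g 0 * h 1 - h 0 * g 1 = 0 := by
  constructor
  · rintro ⟨v, hv, hk⟩
    have e0 := hk 0
    have e1 := hk 1
    have e2 := hk 2
    by_cases h0 : v 0 = 0
    · have h1 : v 1 ≠ 0 := fun h1 => hv (by ext i; fin_cases i <;> simpa)
      refine ⟨?_, ?_, ?_⟩ <;> refine (mul_eq_zero.1 ?_).resolve_left h1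
      · linear_combination g 1 * e2 - g 2 * e1
      · linear_combination g 2 * e0 - g 0 * e2
      · linear_combination g 0 * e1 - g 1 * e0
    · refine ⟨?_, ?_, ?_⟩ <;> refine (mul_eq_zero.1 ?_).resolve_left h0
      · linear_combination h 2 * e1 - h 1 * e2
      · linear_combination h 0 * e2 - h 2 * e0
      · linear_combination h 1 * e0 - h 0 * e1
  · rintro ⟨h12, h20, h01⟩
    by_cases hg : ∀ k, g k = 0
    · exact ⟨![1, 0], fun h => by simpa using congrFun h 0, fun i => by simp [hg i]⟩
    · push Not at hg
      obtain ⟨k, hk⟩ := hg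
      refine ⟨![h k, -g k], fun h => hk (by simpa using congrFun h 1), fun i => ?_⟩
      simp only [Matrix.cons_val_zero, Matrix.cons_val_one]
      fin_cases k <;> fin_cases i <;> simp only [Fin.mk_zero, Fin.mk_one, Fin.reduceFinMk] <;>
        first
        | ring1
        | linear_combination h12
        | linear_combination -h12
        | linear_combination h20
        | linear_combination -h20
        | linear_combination h01
        | linear_combination -h01

lemma eval_pderiv_zero (F : Omega) (p : Fin 2 → ℂ) (i : Fin 3) :
    eval p (pderiv 0 (F i).1) =
      coeffs F (i, 1) + 2 * coeffs F (i, 3) * p 0 + coeffs F (i, 4) * p 1 := by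
  rw [val_eq F i]
  simp [pderiv_X]
  ring

lemma eval_pderiv_one (F : Omega) (p : Fin 2 → ℂ) (i : Fin 3) :
    eval p (pderiv 1 (F i).1) =
      coeffs F (i, 2) + coeffs F (i, 4) * p 0 + 2 * coeffs F (i, 5) * p 1 := by
  rw [val_eq F i]
  simp [pderiv_X]
  ring

lemma criticalSet_eq_crit (F : Omega) : criticalSet F = crit (toMap F) := by
  ext p
  rw [toMap_eq_quadMap, mem_crit_quadMap]
  have h := exists_combination_eq_zero_iff (fun i => eval p (pderiv 0 (F i).1))
    (fun i => eval p (pderiv 1 (F i).1))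
  simp only [criticalSet, jac, Set.mem_ofPred_eq, map_sub, map_mul]
  rw [← h]
  refine exists_congr fun v => and_congr_right fun _ => forall_congr' fun i => ?_
  rw [eval_pderiv_zero, eval_pderiv_one]
  constructor <;> intro h <;> linear_combination h

/-- Central symmetry is an affine notion, so the description by `crit` makes affine invariance
immediate, without the chain rule. -/
lemma crit_comp (f : (Fin 2 → ℂ) → Fin 3 → ℂ) (L : (Fin 3 → ℂ) ≃ᵃ[ℂ] (Fin 3 → ℂ))
    (R : (Fin 2 → ℂ) ≃ᵃ[ℂ] (Fin 2 → ℂ)) : crit (L ∘ f ∘ R) = R ⁻¹' crit f := by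
  have hadd : ∀ p v, R (p + v) = R p + R.linear v := fun p v => by
    simpa [add_comm] using R.map_vadd p v
  have hsub : ∀ p v, R (p - v) = R p - R.linear v := fun p v => by
    rw [sub_eq_add_neg, hadd, map_neg, sub_eq_add_neg]
  ext p
  simp only [crit, Set.mem_ofPred_eq, Set.mem_preimage, Function.comp_apply, hadd, hsub,
    L.injective.eq_iff]
  constructor
  · rintro ⟨v, hv, h⟩
    exact ⟨R.linear v, by simpa using hv, h⟩
  · rintro ⟨v, hv, h⟩
    exact ⟨R.linear.symm v, by simpa using hv, by simpa using h⟩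

lemma encard_crit_comp (f : (Fin 2 → ℂ) → Fin 3 → ℂ) (L : (Fin 3 → ℂ) ≃ᵃ[ℂ] (Fin 3 → ℂ))
    (R : (Fin 2 → ℂ) ≃ᵃ[ℂ] (Fin 2 → ℂ)) : (crit (L ∘ f ∘ R)).encard = (crit f).encard := by
  rw [crit_comp]
  exact Set.encard_preimage_of_bijective R.bijective _

/-! ### Linear equivalence is an equivalence relation -/

lemma mem_orbit_self (F : Omega) : F ∈ orbit F :=
  ⟨AffineEquiv.refl ℂ _, AffineEquiv.refl ℂ _, rfl⟩

lemma mem_orbit_symm {F G : Omega} (h : F ∈ orbit G) : G ∈ orbit F := by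
  obtain ⟨L, R, h⟩ := h
  refine ⟨L.symm, R.symm, ?_⟩
  rw [h]
  funext p
  simp

lemma mem_orbit_trans {F G H : Omega} (h : F ∈ orbit G) (h' : G ∈ orbit H) : F ∈ orbit H := by
  obtain ⟨L, R, h⟩ := h
  obtain ⟨L', R', h'⟩ := h'
  exact ⟨L'.trans L, R.trans R', by rw [h, h']; rfl⟩

lemma orbit_eq_of_mem {F G : Omega} (h : F ∈ orbit G) : orbit F = orbit G :=
  Set.ext fun _ => ⟨fun h' => mem_orbit_trans h' h,
    fun h' => mem_orbit_trans h' (mem_orbit_symm h)⟩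

/-! ### Binary cubic forms and their discriminants -/

/-- The determinant of three column vectors. -/
def det3 {S : Type*} [CommRing S] (u v w : Fin 3 → S) : S :=
  u 0 * (v 1 * w 2 - v 2 * w 1) - u 1 * (v 0 * w 2 - v 2 * w 0) + u 2 * (v 0 * w 1 - v 1 * w 0)

/-- The vector formed by the coefficients of the `j`-th monomial. -/
def col {S : Type*} (c : Fin 3 × Fin 6 → S) (j : Fin 6) : Fin 3 → S := fun i => c (i, j)

/-- The determinant of the quadratic part. -/
def quadDet {S : Type*} [CommRing S] (c : Fin 3 × Fin 6 → S) : S :=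
  det3 (col c 3) (col c 4) (col c 5)

/-- The coefficients of the binary cubic form whose roots are the kernel directions at the
singular points. -/
def cubicCoeff {S : Type*} [CommRing S] (c : Fin 3 × Fin 6 → S) : Fin 4 → S :=
  ![det3 (col c 3) (col c 4) (col c 1),
    det3 (col c 3) (col c 4) (col c 2) - 2 * det3 (col c 3) (col c 1) (col c 5),
    det3 (col c 1) (col c 4) (col c 5) - 2 * det3 (col c 3) (col c 2) (col c 5),
    det3 (col c 2) (col c 4) (col c 5)]

/-- The value of a binary cubic form. -/
def cubicForm (k : Fin 4 → ℂ) (v : Fin 2 → ℂ) : ℂ :=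
  k 0 * v 0 ^ 3 + k 1 * v 0 ^ 2 * v 1 + k 2 * v 0 * v 1 ^ 2 + k 3 * v 1 ^ 3

/-- The discriminant of a binary cubic form. -/
def cubicDisc {S : Type*} [CommRing S] (k : Fin 4 → S) : S :=
  k 1 ^ 2 * k 2 ^ 2 - 4 * k 0 * k 2 ^ 3 - 4 * k 1 ^ 3 * k 3 - 27 * k 0 ^ 2 * k 3 ^ 2 +
    18 * k 0 * k 1 * k 2 * k 3

/-- The polynomial in the coefficients of a quadratic mapping that detects three singular
points. -/
def orbitDisc {S : Type*} [CommRing S] (c : Fin 3 × Fin 6 → S) : S :=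
  quadDet c * cubicDisc (cubicCoeff c)

/-- The determinant of two vectors of the plane. -/
def det2 (v w : Fin 2 → ℂ) : ℂ := v 0 * w 1 - v 1 * w 0

lemma vec2_ne_zero {v : Fin 2 → ℂ} (hv : v ≠ 0) : v 0 ≠ 0 ∨ v 1 ≠ 0 := by
  by_contra! h
  exact hv (by ext i; fin_cases i; exacts [h.1, h.2])

/-- Two vectors with nonzero determinant have no common nonzero annihilator. -/
lemma eq_zero_of_det2_ne_zero {v w : Fin 2 → ℂ} (h : det2 v w ≠ 0) {p q : ℂ}
    (hv : p * v 0 + q * v 1 = 0) (hw : p * w 0 + q * w 1 = 0) : p = 0 ∧ q = 0 := by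
  unfold det2 at h
  constructor <;> refine (mul_eq_zero.1 ?_).resolve_right h
  · linear_combination w 1 * hv - v 1 * hw
  · linear_combination v 0 * hw - w 0 * hv

/-- A vector whose determinant with `v ≠ 0` vanishes is a multiple of `v`. -/
lemma exists_smul_of_det2_eq_zero {v w : Fin 2 → ℂ} (hv : v ≠ 0) (h : det2 v w = 0) :
    ∃ t : ℂ, w = t • v := by
  unfold det2 at h
  rcases vec2_ne_zero hv with h0 | h0
  · refine ⟨w 0 / v 0, ?_⟩
    ext i
    fin_cases i <;> simp <;> field_simp
    linear_combination h
  · refine ⟨w 1 / v 1, ?_⟩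
    ext i
    fin_cases i <;> simp <;> field_simp
    linear_combination -h

lemma exists_quadratic_factors (a b c : ℂ) : ∃ p q r s : ℂ,
    a = p * r ∧ b = p * s + q * r ∧ c = q * s := by
  by_cases ha : a = 0
  · exact ⟨0, 1, b, c, by simp [ha], by simp, by simp⟩
  · obtain ⟨x, hx⟩ := IsAlgClosed.exists_root (Cubic.toPoly ⟨0, a, b, c⟩)
      (by rw [Cubic.degree_of_b_ne_zero' ha]; decide)
    simp [Cubic.toPoly] at hx
    exact ⟨1, -x, a, b + a * x, by ring, by ring, by linear_combination hx⟩

/-- A binary cubic form over the complex numbers is a product of linear forms. -/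
lemma exists_cubic_factors (k : Fin 4 → ℂ) : ∃ p q : Fin 3 → ℂ,
    k 0 = p 0 * p 1 * p 2 ∧ k 1 = p 0 * p 1 * q 2 + p 0 * q 1 * p 2 + q 0 * p 1 * p 2 ∧
    k 2 = p 0 * q 1 * q 2 + q 0 * p 1 * q 2 + q 0 * q 1 * p 2 ∧ k 3 = q 0 * q 1 * q 2 := by
  by_cases ha : k 0 = 0
  · obtain ⟨p, q, r, s, h1, h2, h3⟩ := exists_quadratic_factors (k 1) (k 2) (k 3)
    refine ⟨![0, p, r], ![1, q, s], ?_, ?_, ?_, ?_⟩ <;> simp [ha, h1, h2, h3]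
  · obtain ⟨x, hx⟩ := IsAlgClosed.exists_root (Cubic.toPoly ⟨k 0, k 1, k 2, k 3⟩)
      (by rw [Cubic.degree_of_a_ne_zero' ha]; decide)
    simp [Cubic.toPoly] at hx
    -- These are the coefficients of the quotient by the factor with root `x`, from synthetic
    -- division.
    obtain ⟨p, q, r, s, h1, h2, h3⟩ :=
      exists_quadratic_factors (k 0) (k 1 + k 0 * x) (k 2 + (k 1 + k 0 * x) * x)
    refine ⟨![1, p, r], ![-x, q, s], ?_, ?_, ?_, ?_⟩ <;> simp
    · exact h1
    · linear_combination h2 - x * h1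
    · linear_combination h3 - x * h2
    · linear_combination hx - x * h3

lemma cubicForm_eq_prod {k : Fin 4 → ℂ} {p q : Fin 3 → ℂ} (h0 : k 0 = p 0 * p 1 * p 2)
    (h1 : k 1 = p 0 * p 1 * q 2 + p 0 * q 1 * p 2 + q 0 * p 1 * p 2)
    (h2 : k 2 = p 0 * q 1 * q 2 + q 0 * p 1 * q 2 + q 0 * q 1 * p 2)
    (h3 : k 3 = q 0 * q 1 * q 2) (v : Fin 2 → ℂ) :
    cubicForm k v =
      (p 0 * v 0 + q 0 * v 1) * (p 1 * v 0 + q 1 * v 1) * (p 2 * v 0 + q 2 * v 1) := by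
  rw [cubicForm, h0, h1, h2, h3]
  ring

lemma cubicDisc_eq_prod {k : Fin 4 → ℂ} {p q : Fin 3 → ℂ} (h0 : k 0 = p 0 * p 1 * p 2)
    (h1 : k 1 = p 0 * p 1 * q 2 + p 0 * q 1 * p 2 + q 0 * p 1 * p 2)
    (h2 : k 2 = p 0 * q 1 * q 2 + q 0 * p 1 * q 2 + q 0 * q 1 * p 2)
    (h3 : k 3 = q 0 * q 1 * q 2) :
    cubicDisc k = ((p 0 * q 1 - p 1 * q 0) * (p 0 * q 2 - p 2 * q 0) *
      (p 1 * q 2 - p 2 * q 1)) ^ 2 := by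
  rw [cubicDisc, h0, h1, h2, h3]
  ring

/-- If two of three linear forms are proportional and the product of the three vanishes at three
pairwise independent vectors, then one of the forms is zero. -/
lemma exists_linear_form_eq_zero {p₁ q₁ p₂ q₂ p₃ q₃ : ℂ} (h : p₁ * q₂ - p₂ * q₁ = 0)
    {u v w : Fin 2 → ℂ} (huv : det2 u v ≠ 0) (huw : det2 u w ≠ 0) (hvw : det2 v w ≠ 0)
    (H : ∀ z, z = u ∨ z = v ∨ z = w →
      (p₁ * z 0 + q₁ * z 1) * (p₂ * z 0 + q₂ * z 1) * (p₃ * z 0 + q₃ * z 1) = 0) :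
    (p₁ = 0 ∧ q₁ = 0) ∨ (p₂ = 0 ∧ q₂ = 0) ∨ (p₃ = 0 ∧ q₃ = 0) := by
  by_cases h2 : p₂ = 0 ∧ q₂ = 0
  · exact Or.inr (Or.inl h2)
  -- The second form is nonzero and proportional to the first, so its zeros are zeros of the first.
  -- By pigeonhole, the first or the third form then vanishes at two independent vectors.
  have H' : ∀ z, z = u ∨ z = v ∨ z = w →
      p₁ * z 0 + q₁ * z 1 = 0 ∨ p₃ * z 0 + q₃ * z 1 = 0 := by
    intro z hz
    rcases mul_eq_zero.1 (H z hz) with h' | h'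
    · rcases mul_eq_zero.1 h' with h' | h'
      · exact Or.inl h'
      · left
        by_cases hp : p₂ = 0
        · have hq : q₂ ≠ 0 := fun hq => h2 ⟨hp, hq⟩
          refine (mul_eq_zero.1 ?_).resolve_left hq
          linear_combination z 0 * h + q₁ * h'
        · refine (mul_eq_zero.1 ?_).resolve_left hp
          linear_combination -z 1 * h + p₁ * h'
    · exact Or.inr h'
  rcases H' u (by simp) with hu | hu <;> rcases H' v (by simp) with hv | hv <;>
    rcases H' w (by simp) with hw | hw
  · exact Or.inl (eq_zero_of_det2_ne_zero huv hu hv)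
  · exact Or.inl (eq_zero_of_det2_ne_zero huv hu hv)
  · exact Or.inl (eq_zero_of_det2_ne_zero huw hu hw)
  · exact Or.inr (Or.inr (eq_zero_of_det2_ne_zero hvw hv hw))
  · exact Or.inl (eq_zero_of_det2_ne_zero hvw hv hw)
  · exact Or.inr (Or.inr (eq_zero_of_det2_ne_zero huw hu hw))
  · exact Or.inr (Or.inr (eq_zero_of_det2_ne_zero huv hu hv))
  · exact Or.inr (Or.inr (eq_zero_of_det2_ne_zero huv hu hv))

/-- A binary cubic form with zero discriminant and three distinct projective roots is zero. -/
lemma cubic_eq_zero_of_disc_eq_zero {k : Fin 4 → ℂ} (hk : cubicDisc k = 0)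
    {u v w : Fin 2 → ℂ} (huv : det2 u v ≠ 0) (huw : det2 u w ≠ 0) (hvw : det2 v w ≠ 0)
    (hu : cubicForm k u = 0) (hv : cubicForm k v = 0) (hw : cubicForm k w = 0) : k = 0 := by
  obtain ⟨p, q, h0, h1, h2, h3⟩ := exists_cubic_factors k
  have hform := cubicForm_eq_prod h0 h1 h2 h3
  have H : ∀ z, z = u ∨ z = v ∨ z = w → cubicForm k z = 0 := by
    rintro z (rfl | rfl | rfl) <;> assumption
  rw [cubicDisc_eq_prod h0 h1 h2 h3] at hk
  have key : (p 0 = 0 ∧ q 0 = 0) ∨ (p 1 = 0 ∧ q 1 = 0) ∨ (p 2 = 0 ∧ q 2 = 0) := by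
    rcases mul_eq_zero.1 (pow_eq_zero_iff (two_ne_zero) |>.1 hk) with h | h
    · rcases mul_eq_zero.1 h with h | h
      · exact exists_linear_form_eq_zero h huv huw hvw fun z hz => by rw [← hform, H z hz]
      · have := exists_linear_form_eq_zero (p₃ := p 1) (q₃ := q 1) h huv huw hvw
          fun z hz => by linear_combination H z hz - hform z
        tauto
    · have := exists_linear_form_eq_zero (p₃ := p 0) (q₃ := q 0) h huv huw hvw
        fun z hz => by linear_combination H z hz - hform z
      tauto
  ext i
  rcases key with ⟨a, b⟩ | ⟨a, b⟩ | ⟨a, b⟩ <;> fin_cases i <;> simp [h0, h1, h2, h3, a, b]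

/-! ### Eliminating the point from the kernel equation -/

lemma IsKer.smul {c : Fin 3 × Fin 6 → ℂ} {p v : Fin 2 → ℂ} (h : IsKer c p v) (t : ℂ) :
    IsKer c p (t • v) := by
  intro i
  simp only [Pi.smul_apply, smul_eq_mul]
  linear_combination t * h i

/-- The kernel equation solved for the quadratic part by Cramer's rule. -/
lemma IsKer.cramer {c : Fin 3 × Fin 6 → ℂ} {p v : Fin 2 → ℂ} (h : IsKer c p v) :
    2 * (p 0 * v 0) * quadDet c + v 0 * det3 (col c 1) (col c 4) (col c 5) +
        v 1 * det3 (col c 2) (col c 4) (col c 5) = 0 ∧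
    (p 0 * v 1 + p 1 * v 0) * quadDet c + v 0 * det3 (col c 3) (col c 1) (col c 5) +
        v 1 * det3 (col c 3) (col c 2) (col c 5) = 0 ∧
    2 * (p 1 * v 1) * quadDet c + v 0 * det3 (col c 3) (col c 4) (col c 1) +
        v 1 * det3 (col c 3) (col c 4) (col c 2) = 0 := by
  have e0 := h 0
  have e1 := h 1
  have e2 := h 2
  simp only [quadDet, det3, col]
  refine ⟨?_, ?_, ?_⟩
  · linear_combination (c (1, 4) * c (2, 5) - c (2, 4) * c (1, 5)) * e0 -
      (c (0, 4) * c (2, 5) - c (2, 4) * c (0, 5)) * e1 +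
      (c (0, 4) * c (1, 5) - c (1, 4) * c (0, 5)) * e2
  · linear_combination -(c (1, 3) * c (2, 5) - c (2, 3) * c (1, 5)) * e0 +
      (c (0, 3) * c (2, 5) - c (2, 3) * c (0, 5)) * e1 -
      (c (0, 3) * c (1, 5) - c (1, 3) * c (0, 5)) * e2
  · linear_combination (c (1, 3) * c (2, 4) - c (2, 3) * c (1, 4)) * e0 -
      (c (0, 3) * c (2, 4) - c (2, 3) * c (0, 4)) * e1 +
      (c (0, 3) * c (1, 4) - c (1, 3) * c (0, 4)) * e2

lemma isKer_of_cramer {c : Fin 3 × Fin 6 → ℂ} (hD : quadDet c ≠ 0) {p v : Fin 2 → ℂ}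
    (h₁ : 2 * (p 0 * v 0) * quadDet c + v 0 * det3 (col c 1) (col c 4) (col c 5) +
        v 1 * det3 (col c 2) (col c 4) (col c 5) = 0)
    (h₂ : (p 0 * v 1 + p 1 * v 0) * quadDet c + v 0 * det3 (col c 3) (col c 1) (col c 5) +
        v 1 * det3 (col c 3) (col c 2) (col c 5) = 0)
    (h₃ : 2 * (p 1 * v 1) * quadDet c + v 0 * det3 (col c 3) (col c 4) (col c 1) +
        v 1 * det3 (col c 3) (col c 4) (col c 2) = 0) : IsKer c p v := by
  -- Cramer's expansion of `c_k` in the columns of the quadratic part.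
  have key : ∀ (k : Fin 6) (i : Fin 3), quadDet c * c (i, k) =
      det3 (col c k) (col c 4) (col c 5) * c (i, 3) +
      det3 (col c 3) (col c k) (col c 5) * c (i, 4) +
      det3 (col c 3) (col c 4) (col c k) * c (i, 5) := by
    intro k i
    simp only [quadDet, det3, col]
    fin_cases i <;> simp only [Fin.mk_zero, Fin.mk_one, Fin.reduceFinMk] <;> ring
  intro i
  refine (mul_eq_zero.1 ?_).resolve_left hD
  linear_combination v 0 * key 1 i + v 1 * key 2 i + c (i, 3) * h₁ + c (i, 4) * h₂ +
    c (i, 5) * h₃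

/-- Weighting the three Cramer equations by `v₁²`, `-2v₀v₁`, `v₀²` cancels every term containing
`p`. -/
lemma IsKer.cubicForm_eq_zero {c : Fin 3 × Fin 6 → ℂ} {p v : Fin 2 → ℂ} (h : IsKer c p v) :
    cubicForm (cubicCoeff c) v = 0 := by
  obtain ⟨h₁, h₂, h₃⟩ := h.cramer
  simp only [cubicForm, cubicCoeff, Matrix.cons_val]
  linear_combination v 1 ^ 2 * h₁ - 2 * v 0 * v 1 * h₂ + v 0 ^ 2 * h₃

/-- Two of the Cramer equations can be solved for `p` after dividing by a nonzero coordinate of `v`;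
the vanishing of the cubic form is then exactly the third, multiplied by the square of that
coordinate. -/
lemma exists_isKer {c : Fin 3 × Fin 6 → ℂ} (hD : quadDet c ≠ 0) {v : Fin 2 → ℂ} (hv : v ≠ 0)
    (h : cubicForm (cubicCoeff c) v = 0) : ∃ p, IsKer c p v := by
  simp only [cubicForm, cubicCoeff, Matrix.cons_val] at h
  set D := quadDet c with hDdef
  set n11 := det3 (col c 1) (col c 4) (col c 5)
  set n12 := det3 (col c 2) (col c 4) (col c 5)
  set n21 := det3 (col c 3) (col c 1) (col c 5)
  set n22 := det3 (col c 3) (col c 2) (col c 5)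
  set n31 := det3 (col c 3) (col c 4) (col c 1)
  set n32 := det3 (col c 3) (col c 4) (col c 2)
  rcases vec2_ne_zero hv with h0 | h0
  · set x := -(v 0 * n11 + v 1 * n12) / (2 * v 0 * D) with hx
    have hx' : 2 * v 0 * D * x = -(v 0 * n11 + v 1 * n12) := by rw [hx]; field_simp
    set y := (-(v 0 * n21 + v 1 * n22) - x * v 1 * D) / (v 0 * D) with hy
    have hy' : v 0 * D * y = -(v 0 * n21 + v 1 * n22) - x * v 1 * D := by rw [hy]; field_simp
    refine ⟨![x, y], isKer_of_cramer hD ?_ ?_ ?_⟩ <;>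
      simp only [Matrix.cons_val_zero, Matrix.cons_val_one]
    · linear_combination hx'
    · linear_combination hy'
    · refine (mul_eq_zero.1 ?_).resolve_left (pow_ne_zero 2 h0)
      linear_combination h + 2 * v 0 * v 1 * hy' - v 1 ^ 2 * hx'
  · set y := -(v 0 * n31 + v 1 * n32) / (2 * v 1 * D) with hy
    have hy' : 2 * v 1 * D * y = -(v 0 * n31 + v 1 * n32) := by rw [hy]; field_simp
    set x := (-(v 0 * n21 + v 1 * n22) - y * v 0 * D) / (v 1 * D) with hx
    have hx' : v 1 * D * x = -(v 0 * n21 + v 1 * n22) - y * v 0 * D := by rw [hx]; field_simp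
    refine ⟨![x, y], isKer_of_cramer hD ?_ ?_ ?_⟩ <;>
      simp only [Matrix.cons_val_zero, Matrix.cons_val_one]
    · refine (mul_eq_zero.1 ?_).resolve_left (pow_ne_zero 2 h0)
      linear_combination h + 2 * v 0 * v 1 * hx' - v 0 ^ 2 * hy'
    · linear_combination hx'
    · linear_combination hy'

/-- The difference of the two kernel equations says that the product of the linear forms with
coefficients `p - q` and `v` is zero, and `v ≠ 0`. -/
lemma IsKer.point_unique {c : Fin 3 × Fin 6 → ℂ} (hD : quadDet c ≠ 0) {p q v : Fin 2 → ℂ}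
    (hv : v ≠ 0) (hp : IsKer c p v) (hq : IsKer c q v) : p = q := by
  obtain ⟨p₁, p₂, p₃⟩ := hp.cramer
  obtain ⟨q₁, q₂, q₃⟩ := hq.cramer
  have e₁ : (p 0 - q 0) * v 0 = 0 := by
    refine (mul_eq_zero.1 ?_).resolve_left hD
    linear_combination (p₁ - q₁) / 2
  have e₂ : (p 0 - q 0) * v 1 + (p 1 - q 1) * v 0 = 0 := by
    refine (mul_eq_zero.1 ?_).resolve_left hD
    linear_combination p₂ - q₂
  have e₃ : (p 1 - q 1) * v 1 = 0 := by
    refine (mul_eq_zero.1 ?_).resolve_left hD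
    linear_combination (p₃ - q₃) / 2
  have h01 : p 0 - q 0 = 0 ∧ p 1 - q 1 = 0 := by
    rcases vec2_ne_zero hv with h0 | h0
    · have hx := (mul_eq_zero.1 e₁).resolve_right h0
      rw [hx, zero_mul, zero_add] at e₂
      exact ⟨hx, (mul_eq_zero.1 e₂).resolve_right h0⟩
    · have hy := (mul_eq_zero.1 e₃).resolve_right h0
      rw [hy, zero_mul, add_zero] at e₂
      exact ⟨(mul_eq_zero.1 e₂).resolve_right h0, hy⟩
  ext i
  fin_cases i
  · exact sub_eq_zero.1 h01.1
  · exact sub_eq_zero.1 h01.2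

/-- If the differential vanishes at some point, then the cubic form is zero. -/
lemma cubicCoeff_eq_zero_of_isKer {c : Fin 3 × Fin 6 → ℂ} {p v w : Fin 2 → ℂ}
    (hvw : det2 v w ≠ 0) (hv : IsKer c p v) (hw : IsKer c p w) : cubicCoeff c = 0 := by
  obtain ⟨v₁, v₂, v₃⟩ := hv.cramer
  obtain ⟨w₁, w₂, w₃⟩ := hw.cramer
  obtain ⟨a₁, b₁⟩ := eq_zero_of_det2_ne_zero hvw
    (p := 2 * p 0 * quadDet c + det3 (col c 1) (col c 4) (col c 5))
    (q := det3 (col c 2) (col c 4) (col c 5)) (by linear_combination v₁)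
    (by linear_combination w₁)
  obtain ⟨a₂, b₂⟩ := eq_zero_of_det2_ne_zero hvw
    (p := p 1 * quadDet c + det3 (col c 3) (col c 1) (col c 5))
    (q := p 0 * quadDet c + det3 (col c 3) (col c 2) (col c 5)) (by linear_combination v₂)
    (by linear_combination w₂)
  obtain ⟨a₃, b₃⟩ := eq_zero_of_det2_ne_zero hvw
    (p := det3 (col c 3) (col c 4) (col c 1))
    (q := 2 * p 1 * quadDet c + det3 (col c 3) (col c 4) (col c 2)) (by linear_combination v₃)
    (by linear_combination w₃)
  ext i
  fin_cases i <;> simp [cubicCoeff]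
  · exact a₃
  · linear_combination b₃ - 2 * a₂
  · linear_combination a₁ - 2 * b₂
  · exact b₁

/-- If the cubic form is zero, then there is at most one singular point. -/
lemma point_unique_of_cubicCoeff_eq_zero {c : Fin 3 × Fin 6 → ℂ} (hD : quadDet c ≠ 0)
    (hk : cubicCoeff c = 0) {p q v w : Fin 2 → ℂ} (hv : v ≠ 0) (hw : w ≠ 0)
    (hp : IsKer c p v) (hq : IsKer c q w) : p = q := by
  have k0 := congrFun hk 0
  have k1 := congrFun hk 1
  have k2 := congrFun hk 2
  have k3 := congrFun hk 3
  simp only [cubicCoeff, Matrix.cons_val, Pi.zero_apply] at k0 k1 k2 k3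
  set n11 := det3 (col c 1) (col c 4) (col c 5)
  set n32 := det3 (col c 3) (col c 4) (col c 2)
  have key : ∀ p v : Fin 2 → ℂ, v ≠ 0 → IsKer c p v →
      2 * quadDet c * p 0 + n11 = 0 ∧ 2 * quadDet c * p 1 + n32 = 0 := by
    intro p v hv hp
    obtain ⟨p₁, p₂, p₃⟩ := hp.cramer
    have e₁ : (2 * quadDet c * p 0 + n11) * v 0 = 0 := by
      linear_combination p₁ - v 1 * k3
    have e₂ : (2 * quadDet c * p 0 + n11) * v 1 + (2 * quadDet c * p 1 + n32) * v 0 = 0 := by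
      linear_combination 2 * p₂ + v 1 * k2 + v 0 * k1
    have e₃ : (2 * quadDet c * p 1 + n32) * v 1 = 0 := by
      linear_combination p₃ - v 0 * k0
    rcases vec2_ne_zero hv with h0 | h0
    · have hx := (mul_eq_zero.1 e₁).resolve_right h0
      rw [hx, zero_mul, zero_add] at e₂
      exact ⟨hx, (mul_eq_zero.1 e₂).resolve_right h0⟩
    · have hy := (mul_eq_zero.1 e₃).resolve_right h0
      rw [hy, zero_mul, add_zero] at e₂
      exact ⟨(mul_eq_zero.1 e₂).resolve_right h0, hy⟩
  obtain ⟨p₀, p₁⟩ := key p v hv hp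
  obtain ⟨q₀, q₁⟩ := key q w hw hq
  have h2 : 2 * quadDet c ≠ 0 := mul_ne_zero two_ne_zero hD
  have h0 : p 0 = q 0 := mul_left_cancel₀ h2 (by linear_combination p₀ - q₀)
  have h1 : p 1 = q 1 := mul_left_cancel₀ h2 (by linear_combination p₁ - q₁)
  ext i
  fin_cases i
  exacts [h0, h1]

/-! ### Degenerate configurations with infinitely many singular points -/

/-- If two points have a common kernel direction, then the line through them is singular. -/
lemma crit_infinite_of_isKer {c : Fin 3 × Fin 6 → ℂ} {p q v w : Fin 2 → ℂ} (hpq : p ≠ q)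
    (hv : v ≠ 0) (hw : w ≠ 0) (hvw : det2 v w = 0) (hp : IsKer c p v) (hq : IsKer c q w) :
    (crit (quadMap c)).Infinite := by
  have hq' : IsKer c q v := by
    obtain ⟨t, rfl⟩ := exists_smul_of_det2_eq_zero hw
      (w := v) (by unfold det2 at *; linear_combination -hvw)
    exact hq.smul t
  refine Set.infinite_of_injective_forall_mem (f := fun t : ℂ => p + t • (q - p)) ?_ ?_
  · intro s t hst
    have h := add_left_cancel hst
    exact smul_left_injective ℂ (sub_ne_zero.2 hpq.symm) h
  · intro t
    refine mem_crit_quadMap.2 ⟨v, hv, fun i => ?_⟩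
    simp only [Pi.add_apply, Pi.smul_apply, Pi.sub_apply, smul_eq_mul]
    -- For a fixed direction the kernel equation is affine in the point.
    linear_combination (1 - t) * hp i + t * hq' i

/-- The zero set of a polynomial of degree at most two in the plane is empty or infinite. -/
lemma conic_infinite (k : Fin 6 → ℂ) {S : Set (Fin 2 → ℂ)}
    (hS : ∀ p : Fin 2 → ℂ, p ∈ S ↔ k 0 + k 1 * p 0 + k 2 * p 1 + k 3 * p 0 ^ 2 +
      k 4 * (p 0 * p 1) + k 5 * p 1 ^ 2 = 0) (hne : S.Nonempty) : S.Infinite := by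
  by_cases h5 : k 5 = 0
  · by_cases h24 : k 2 = 0 ∧ k 4 = 0
    · obtain ⟨p, hp⟩ := hne
      refine Set.infinite_of_injective_forall_mem (f := fun t : ℂ => ![p 0, t]) ?_ ?_
      · intro s t hst
        simpa using congrFun hst 1
      · intro t
        rw [hS] at hp ⊢
        simp [h5, h24.1, h24.2] at hp ⊢
        exact hp
    -- The equation is now linear in the second coordinate, with a leading coefficient that vanishes
    -- for at most one `t`; elsewhere it can be solved.
    · have hfin : {t : ℂ | k 2 + k 4 * t = 0}.Finite := by
        refine Set.Subsingleton.finite fun s hs t ht => ?_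
        simp only [Set.mem_ofPred_eq] at hs ht
        have h4 : k 4 ≠ 0 := fun h4 => h24 ⟨by simpa [h4] using hs, h4⟩
        exact mul_left_cancel₀ h4 (by linear_combination hs - ht)
      refine Set.Infinite.mono (s := (fun t : ℂ =>
        ![t, -(k 0 + k 1 * t + k 3 * t ^ 2) / (k 2 + k 4 * t)]) ''
          {t : ℂ | k 2 + k 4 * t = 0}ᶜ) ?_ ?_
      · rintro _ ⟨t, ht, rfl⟩
        have ht' : k 2 + k 4 * t ≠ 0 := ht
        rw [hS]
        simp only [Matrix.cons_val_zero, Matrix.cons_val_one, h5]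
        linear_combination -div_mul_cancel₀ (k 0 + k 1 * t + k 3 * t ^ 2) ht'
      · refine Set.Infinite.image ?_ hfin.infinite_compl
        intro s _ t _ hst
        simpa using congrFun hst 0
  · have hroot : ∀ t : ℂ, ∃ y : ℂ, k 0 + k 1 * t + k 2 * y + k 3 * t ^ 2 + k 4 * (t * y) +
        k 5 * y ^ 2 = 0 := by
      intro t
      obtain ⟨y, hy⟩ := IsAlgClosed.exists_root
        (Cubic.toPoly ⟨0, k 5, k 2 + k 4 * t, k 0 + k 1 * t + k 3 * t ^ 2⟩)
        (by rw [Cubic.degree_of_b_ne_zero' h5]; decide)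
      simp [Cubic.toPoly] at hy
      exact ⟨y, by linear_combination hy⟩
    choose y hy using hroot
    refine Set.infinite_of_injective_forall_mem (f := fun t : ℂ => ![t, y t]) ?_ ?_
    · intro s t hst
      simpa using congrFun hst 0
    · intro t
      rw [hS]
      simpa using hy t

/-- For vectors orthogonal to a fixed nonzero vector, one minor decides whether they are
parallel. -/
lemma exists_minor {l : Fin 3 → ℂ} (hl : l ≠ 0) : ∃ a b : Fin 3, ∀ g h : Fin 3 → ℂ,
    l 0 * g 0 + l 1 * g 1 + l 2 * g 2 = 0 → l 0 * h 0 + l 1 * h 1 + l 2 * h 2 = 0 →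
    ((g 1 * h 2 - h 1 * g 2 = 0 ∧ g 2 * h 0 - h 2 * g 0 = 0 ∧ g 0 * h 1 - h 0 * g 1 = 0) ↔
      g a * h b - h a * g b = 0) := by
  have hl' : l 0 ≠ 0 ∨ l 1 ≠ 0 ∨ l 2 ≠ 0 := by
    by_contra! H
    exact hl (by ext i; fin_cases i; exacts [H.1, H.2.1, H.2.2])
  -- The cross product of `g` and `h` is parallel to `l`, so its component at an index where `l` is
  -- nonzero controls the others.
  rcases hl' with h0 | h0 | h0
  · refine ⟨1, 2, fun g h hg hh => ⟨fun H => H.1, fun H => ⟨H, ?_, ?_⟩⟩⟩ <;>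
      refine (mul_eq_zero.1 ?_).resolve_left h0
    · linear_combination g 2 * hh - h 2 * hg + l 1 * H
    · linear_combination h 1 * hg - g 1 * hh + l 2 * H
  · refine ⟨2, 0, fun g h hg hh => ⟨fun H => H.2.1, fun H => ⟨?_, H, ?_⟩⟩⟩ <;>
      refine (mul_eq_zero.1 ?_).resolve_left h0
    · linear_combination h 2 * hg - g 2 * hh + l 0 * H
    · linear_combination g 0 * hh - h 0 * hg + l 2 * H
  · refine ⟨0, 1, fun g h hg hh => ⟨fun H => H.2.2, fun H => ⟨?_, ?_, H⟩⟩⟩ <;>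
      refine (mul_eq_zero.1 ?_).resolve_left h0
    · linear_combination g 1 * hh - h 1 * hg + l 0 * H
    · linear_combination h 0 * hg - g 0 * hh + l 1 * H

/-- If a nontrivial combination of the components is constant, then the singular points form
a conic. -/
lemma crit_infinite_of_constant {c : Fin 3 × Fin 6 → ℂ} {l : Fin 3 → ℂ} (hl : l ≠ 0)
    (h : ∀ j : Fin 6, j ≠ 0 → l 0 * c (0, j) + l 1 * c (1, j) + l 2 * c (2, j) = 0)
    (hne : (crit (quadMap c)).Nonempty) : (crit (quadMap c)).Infinite := by
  have h1 := h 1 (by decide)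
  have h2 := h 2 (by decide)
  have h3 := h 3 (by decide)
  have h4 := h 4 (by decide)
  have h5 := h 5 (by decide)
  obtain ⟨a, b, hab⟩ := exists_minor hl
  refine conic_infinite
    -- These are the coefficients of the Jacobian minor of components `a` and `b`, which alone
    -- decides singularity.
    ![c (a, 1) * c (b, 2) - c (a, 2) * c (b, 1),
      c (a, 1) * c (b, 4) + 2 * c (a, 3) * c (b, 2) - c (a, 4) * c (b, 1) -
        2 * c (a, 2) * c (b, 3),
      2 * c (a, 1) * c (b, 5) + c (a, 4) * c (b, 2) - 2 * c (a, 5) * c (b, 1) -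
        c (a, 2) * c (b, 4),
      2 * c (a, 3) * c (b, 4) - 2 * c (a, 4) * c (b, 3),
      4 * c (a, 3) * c (b, 5) - 4 * c (a, 5) * c (b, 3),
      2 * c (a, 4) * c (b, 5) - 2 * c (a, 5) * c (b, 4)] (fun p => ?_) hne
  have hab := hab (fun i => c (i, 1) + 2 * c (i, 3) * p 0 + c (i, 4) * p 1)
    (fun i => c (i, 2) + c (i, 4) * p 0 + 2 * c (i, 5) * p 1)
    (by linear_combination h1 + 2 * p 0 * h3 + p 1 * h4)
    (by linear_combination h2 + p 0 * h4 + 2 * p 1 * h5)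
  rw [mem_crit_quadMap]
  refine Iff.trans (exists_congr fun v => and_congr_right fun _ => forall_congr' fun i => ?_)
    ((exists_combination_eq_zero_iff
      (fun i => c (i, 1) + 2 * c (i, 3) * p 0 + c (i, 4) * p 1)
      (fun i => c (i, 2) + c (i, 4) * p 0 + 2 * c (i, 5) * p 1)).trans (hab.trans ?_))
  · constructor <;> intro H <;> linear_combination H
  · simp only [Matrix.cons_val]
    constructor <;> intro H <;> linear_combination H

lemma exists_orthogonal_of_det3_eq_zero {u v w : Fin 3 → ℂ} (h : det3 u v w = 0) :
    ∃ l : Fin 3 → ℂ, l ≠ 0 ∧ l 0 * u 0 + l 1 * u 1 + l 2 * u 2 = 0 ∧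
      l 0 * v 0 + l 1 * v 1 + l 2 * v 2 = 0 ∧ l 0 * w 0 + l 1 * w 1 + l 2 * w 2 = 0 := by
  have hdet : (Matrix.of ![u, v, w]).det = 0 := by
    rw [Matrix.det_fin_three, ← h, det3]
    simp
    ring
  obtain ⟨l, hl, hM⟩ := Matrix.exists_mulVec_eq_zero_iff.2 hdet
  refine ⟨l, hl, ?_, ?_, ?_⟩
  · have := congrFun hM 0
    simp [Matrix.mulVec, dotProduct, Fin.sum_univ_three] at this
    linear_combination this
  · have := congrFun hM 1
    simp [Matrix.mulVec, dotProduct, Fin.sum_univ_three] at this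
    linear_combination this
  · have := congrFun hM 2
    simp [Matrix.mulVec, dotProduct, Fin.sum_univ_three] at this
    linear_combination this

/-! ### The criterion for three singular points -/

/-- Three singular points come with pairwise independent kernel directions. -/
lemma exists_kernels {c : Fin 3 × Fin 6 → ℂ} (h : (crit (quadMap c)).encard = 3) :
    ∃ p v : Fin 3 → Fin 2 → ℂ, Function.Injective p ∧ (∀ i, IsKer c (p i) (v i)) ∧
      ∀ i j, i ≠ j → det2 (v i) (v j) ≠ 0 := by
  have hfin : (crit (quadMap c)).Finite := Set.finite_of_encard_eq_coe (k := 3) (by simpa using h)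
  obtain ⟨x, y, z, hxy, hxz, hyz, hS⟩ := Set.encard_eq_three.1 h
  have hp : ∀ i, ![x, y, z] i ∈ crit (quadMap c) := by
    rw [hS]
    intro i
    fin_cases i <;> simp
  choose v hv hker using fun i => mem_crit_quadMap.1 (hp i)
  have hinj : Function.Injective ![x, y, z] := by
    intro i j hij
    fin_cases i <;> fin_cases j <;> simp_all
  exact ⟨![x, y, z], v, hinj, hker, fun i j hij hdet =>
    crit_infinite_of_isKer (hinj.ne hij) (hv i) (hv j) hdet (hker i) (hker j) hfin⟩

/-- Otherwise a functional `l` kills the quadratic part. The linear part of `l ∘ F` annihilates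
every kernel direction, two of which are independent, so `l ∘ F` is constant and the singular set,
being nonempty, is infinite. -/
lemma quadDet_ne_zero {c : Fin 3 × Fin 6 → ℂ} (h : (crit (quadMap c)).encard = 3) :
    quadDet c ≠ 0 := by
  intro hD
  have hfin : (crit (quadMap c)).Finite := Set.finite_of_encard_eq_coe (k := 3) (by simpa using h)
  have hne : (crit (quadMap c)).Nonempty := by
    rw [← Set.encard_ne_zero, h]
    decide
  obtain ⟨p, v, hp, hker, hdet⟩ := exists_kernels h
  obtain ⟨l, hl, h3, h4, h5⟩ := exists_orthogonal_of_det3_eq_zero hD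
  simp only [col] at h3 h4 h5
  have key : ∀ i, (l 0 * c (0, 1) + l 1 * c (1, 1) + l 2 * c (2, 1)) * v i 0 +
      (l 0 * c (0, 2) + l 1 * c (1, 2) + l 2 * c (2, 2)) * v i 1 = 0 := by
    intro i
    linear_combination l 0 * hker i 0 + l 1 * hker i 1 + l 2 * hker i 2 -
      2 * (p i 0 * v i 0) * h3 - (p i 0 * v i 1 + p i 1 * v i 0) * h4 -
      2 * (p i 1 * v i 1) * h5
  obtain ⟨h1, h2⟩ := eq_zero_of_det2_ne_zero (hdet 0 1 (by decide)) (key 0) (key 1)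
  refine crit_infinite_of_constant hl (fun j hj => ?_) hne hfin
  fin_cases j
  · exact absurd rfl hj
  exacts [h1, h2, h3, h4, h5]

/-- The mapping has exactly three singular points if and only if `orbitDisc` does not vanish. -/
theorem encard_crit_eq_three_iff (c : Fin 3 × Fin 6 → ℂ) :
    (crit (quadMap c)).encard = 3 ↔ orbitDisc c ≠ 0 := by
  constructor
  · intro h
    have hD := quadDet_ne_zero h
    obtain ⟨p, v, hp, hker, hdet⟩ := exists_kernels h
    have hv : ∀ i, v i ≠ 0 := by
      intro i hi
      have := hdet i (i + 1) (by fin_cases i <;> decide)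
      simp [hi, det2] at this
    refine mul_ne_zero hD fun hdisc => ?_
    -- The three kernel directions are distinct roots, so zero discriminant would force the cubic
    -- form to vanish identically, leaving room for only one singular point.
    have hk := cubic_eq_zero_of_disc_eq_zero hdisc (hdet 0 1 (by decide)) (hdet 0 2 (by decide))
      (hdet 1 2 (by decide)) (hker 0).cubicForm_eq_zero (hker 1).cubicForm_eq_zero
      (hker 2).cubicForm_eq_zero
    have := hp (point_unique_of_cubicCoeff_eq_zero hD hk (hv 0) (hv 1) (hker 0) (hker 1))
    exact absurd this (by decide)
  · intro h
    have hD : quadDet c ≠ 0 := left_ne_zero_of_mul h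
    have hdisc : cubicDisc (cubicCoeff c) ≠ 0 := right_ne_zero_of_mul h
    have hk : cubicCoeff c ≠ 0 := by
      intro hk
      simp [hk, cubicDisc] at hdisc
    obtain ⟨p, q, h0, h1, h2, h3⟩ := exists_cubic_factors (cubicCoeff c)
    have hform := cubicForm_eq_prod h0 h1 h2 h3
    rw [cubicDisc_eq_prod h0 h1 h2 h3, pow_ne_zero_iff two_ne_zero] at hdisc
    have h12 := right_ne_zero_of_mul hdisc
    have h01 := left_ne_zero_of_mul (left_ne_zero_of_mul hdisc)
    have h02 := right_ne_zero_of_mul (left_ne_zero_of_mul hdisc)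
    -- The roots of the three linear factors.
    set v : Fin 3 → Fin 2 → ℂ := fun i => ![q i, -p i] with hvdef
    have hdet : ∀ i j, i ≠ j → det2 (v i) (v j) ≠ 0 := by
      intro i j hij H
      simp only [det2, hvdef, Matrix.cons_val_zero, Matrix.cons_val_one] at H
      fin_cases i <;> fin_cases j <;> simp only [Fin.mk_zero, Fin.mk_one, Fin.reduceFinMk] at H <;>
        first
        | exact absurd rfl hij
        | exact h01 (by linear_combination H)
        | exact h01 (by linear_combination -H)
        | exact h02 (by linear_combination H)
        | exact h02 (by linear_combination -H)
        | exact h12 (by linear_combination H)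
        | exact h12 (by linear_combination -H)
    have hv : ∀ i, v i ≠ 0 := by
      intro i hi
      have := hdet i (i + 1) (by fin_cases i <;> decide)
      simp [hi, det2] at this
    have hroot : ∀ i, cubicForm (cubicCoeff c) (v i) = 0 := by
      intro i
      rw [hform]
      fin_cases i <;> simp [hvdef] <;> ring_nf <;> simp
    choose P hP using fun i => exists_isKer hD (hv i) (hroot i)
    have hinj : ∀ i j, i ≠ j → P i ≠ P j := by
      intro i j hij hPij
      exact hk (cubicCoeff_eq_zero_of_isKer (hdet i j hij) (hP i) (hPij ▸ hP j))
    rw [Set.encard_eq_three]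
    refine ⟨P 0, P 1, P 2, hinj 0 1 (by decide), hinj 0 2 (by decide), hinj 1 2 (by decide), ?_⟩
    ext x
    simp only [Set.mem_insert_iff, Set.mem_singleton_iff]
    constructor
    · intro hx
      obtain ⟨w, hw, hker⟩ := mem_crit_quadMap.1 hx
      have key : ∀ i, p i * w 0 + q i * w 1 = 0 → x = P i := by
        intro i hi
        obtain ⟨t, ht⟩ := exists_smul_of_det2_eq_zero hw (w := v i) (by
          simp only [det2, hvdef, Matrix.cons_val_zero, Matrix.cons_val_one]
          linear_combination -hi)
        exact IsKer.point_unique hD (hv i) (ht ▸ hker.smul t) (hP i)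
      have hw' := hker.cubicForm_eq_zero
      rw [hform] at hw'
      rcases mul_eq_zero.1 hw' with hw' | hw'
      · rcases mul_eq_zero.1 hw' with hw' | hw'
        · exact Or.inl (key 0 hw')
        · exact Or.inr (Or.inl (key 1 hw'))
      · exact Or.inr (Or.inr (key 2 hw'))
    · rintro (rfl | rfl | rfl) <;> exact mem_crit_quadMap.2 ⟨_, hv _, hP _⟩

/-! ### Reduction to the normal form -/

/-- The mapping `(x², y², (1 - x - y)²)`. -/
def normalMap (p : Fin 2 → ℂ) : Fin 3 → ℂ := ![p 0 ^ 2, p 1 ^ 2, (1 - p 0 - p 1) ^ 2]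

lemma exists_affineEquiv {n : ℕ} (M : Matrix (Fin n) (Fin n) ℂ) (hM : M.det ≠ 0)
    (o : Fin n → ℂ) : ∃ L : (Fin n → ℂ) ≃ᵃ[ℂ] (Fin n → ℂ), ∀ y, L y = o + M.mulVec y :=
  ⟨(Matrix.toLinearEquiv' M (M.invertibleOfIsUnitDet (isUnit_iff_ne_zero.2 hM))).toAffineEquiv.trans
    (AffineEquiv.constVAdd ℂ (Fin n → ℂ) o), fun _ => rfl⟩

lemma exists_affineEquiv_plane (o : Fin 2 → ℂ) {e f : Fin 2 → ℂ} (h : det2 e f ≠ 0) :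
    ∃ R : (Fin 2 → ℂ) ≃ᵃ[ℂ] (Fin 2 → ℂ), ∀ p, R p = o + (p 0 • e + p 1 • f) := by
  obtain ⟨R, hR⟩ := exists_affineEquiv !![e 0, f 0; e 1, f 1]
    (by rw [Matrix.det_fin_two_of]; intro H; exact h (by unfold det2; linear_combination H)) o
  refine ⟨R, fun p => ?_⟩
  rw [hR]
  ext i
  fin_cases i <;> simp [dotProduct, Fin.sum_univ_two] <;> ring

lemma exists_affineEquiv_space (o : Fin 3 → ℂ) {u v w : Fin 3 → ℂ} (h : det3 u v w ≠ 0) :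
    ∃ L : (Fin 3 → ℂ) ≃ᵃ[ℂ] (Fin 3 → ℂ), ∀ y i, L y i =
      o i + (y 0 * u i + y 1 * v i + y 2 * w i) := by
  obtain ⟨L, hL⟩ := exists_affineEquiv (Matrix.of fun i j => ![u, v, w] j i)
    (by
      rw [Matrix.det_fin_three]
      intro H
      simp at H
      exact h (by unfold det3; linear_combination H)) o
  refine ⟨L, fun y i => ?_⟩
  rw [hL]
  simp [Matrix.mulVec, dotProduct, Fin.sum_univ_three]
  ring

lemma exists_quadMap_comp (c : Fin 3 × Fin 6 → ℂ) (o e f : Fin 2 → ℂ) :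
    ∃ c', ∀ p, quadMap c' p = quadMap c (o + (p 0 • e + p 1 • f)) := by
  refine ⟨fun k => ![quadMap c o k.1,
    c (k.1, 1) * e 0 + c (k.1, 2) * e 1 + 2 * c (k.1, 3) * o 0 * e 0 +
      c (k.1, 4) * (o 0 * e 1 + o 1 * e 0) + 2 * c (k.1, 5) * o 1 * e 1,
    c (k.1, 1) * f 0 + c (k.1, 2) * f 1 + 2 * c (k.1, 3) * o 0 * f 0 +
      c (k.1, 4) * (o 0 * f 1 + o 1 * f 0) + 2 * c (k.1, 5) * o 1 * f 1,
    c (k.1, 3) * e 0 ^ 2 + c (k.1, 4) * (e 0 * e 1) + c (k.1, 5) * e 1 ^ 2,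
    2 * c (k.1, 3) * e 0 * f 0 + c (k.1, 4) * (e 0 * f 1 + e 1 * f 0) +
      2 * c (k.1, 5) * e 1 * f 1,
    c (k.1, 3) * f 0 ^ 2 + c (k.1, 4) * (f 0 * f 1) + c (k.1, 5) * f 1 ^ 2] k.2, fun p => ?_⟩
  funext i
  simp only [quadMap, Matrix.cons_val, Pi.add_apply, Pi.smul_apply, smul_eq_mul]
  ring

lemma eq_zero_of_quadDet_ne_zero {c : Fin 3 × Fin 6 → ℂ} (hD : quadDet c ≠ 0) {a b d : ℂ}
    (h : ∀ i, a * c (i, 3) + b * c (i, 4) + d * c (i, 5) = 0) : a = 0 ∧ b = 0 ∧ d = 0 := by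
  have e0 := h 0
  have e1 := h 1
  have e2 := h 2
  refine ⟨?_, ?_, ?_⟩ <;> refine (mul_eq_zero.1 ?_).resolve_left hD <;>
    simp only [quadDet, det3, col]
  · linear_combination (c (1, 4) * c (2, 5) - c (2, 4) * c (1, 5)) * e0 -
      (c (0, 4) * c (2, 5) - c (2, 4) * c (0, 5)) * e1 +
      (c (0, 4) * c (1, 5) - c (1, 4) * c (0, 5)) * e2
  · linear_combination -(c (1, 3) * c (2, 5) - c (2, 3) * c (1, 5)) * e0 +
      (c (0, 3) * c (2, 5) - c (2, 3) * c (0, 5)) * e1 -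
      (c (0, 3) * c (1, 5) - c (1, 3) * c (0, 5)) * e2
  · linear_combination (c (1, 3) * c (2, 4) - c (2, 3) * c (1, 4)) * e0 -
      (c (0, 3) * c (2, 4) - c (2, 3) * c (0, 4)) * e1 +
      (c (0, 3) * c (1, 4) - c (1, 3) * c (0, 4)) * e2

lemma exists_eq_normalMap_of_isKer {c : Fin 3 × Fin 6 → ℂ} (hD : quadDet c ≠ 0)
    {P Q : Fin 2 → ℂ} (h0 : IsKer c 0 ![1, -1]) (hP : IsKer c P ![1, 0])
    (hQ : IsKer c Q ![0, 1]) (hne : P ≠ 0) :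
    ∃ (L : (Fin 3 → ℂ) ≃ᵃ[ℂ] (Fin 3 → ℂ)) (R : (Fin 2 → ℂ) ≃ᵃ[ℂ] (Fin 2 → ℂ)),
      quadMap c = L ∘ normalMap ∘ R := by
  simp only [IsKer, Matrix.cons_val_zero, Matrix.cons_val_one, Pi.zero_apply] at h0 hP hQ
  -- Subtracting the three kernel equations cancels the linear coefficients and leaves a relation
  -- among the independent quadratic columns. It places the singular points at `0`, `(0, s)` and
  -- `(s, 0)`.
  obtain ⟨hP0, hPQ, hQ1⟩ := eq_zero_of_quadDet_ne_zero hD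
    (a := 2 * P 0) (b := P 1 - Q 0) (d := -2 * Q 1)
    (fun i => by linear_combination hP i - hQ i - h0 i)
  have hP0' : P 0 = 0 := by simpa using hP0
  set s := P 1 with hsdef
  have hs : s ≠ 0 := fun hs => hne (by ext i; fin_cases i; exacts [hP0', hs])
  have h1 : ∀ i, c (i, 1) = -s * c (i, 4) := fun i => by
    linear_combination hP i - c (i, 3) * hP0
  have h2 : ∀ i, c (i, 2) = -s * c (i, 4) := fun i => by
    linear_combination h1 i - h0 i
  -- The mapping is now `c₀ + c₃x² + c₅y² + c₄(xy - sx - sy)`, and `2(xy - sx - sy) = (s - x - y)² -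
  -- x² - y² - s²`. Rescaling the plane by `s⁻¹` produces the factors `s²`.
  obtain ⟨L, hL⟩ := exists_affineEquiv_space (fun i => c (i, 0) - s ^ 2 * c (i, 4) / 2)
    (u := fun i => s ^ 2 * (c (i, 3) - c (i, 4) / 2))
    (v := fun i => s ^ 2 * (c (i, 5) - c (i, 4) / 2)) (w := fun i => s ^ 2 * (c (i, 4) / 2))
    (by
      intro H
      refine mul_ne_zero (pow_ne_zero 6 hs) hD ?_
      simp only [quadDet, det3, col] at H ⊢
      linear_combination -2 * H)
  obtain ⟨R, hR⟩ := exists_affineEquiv_plane 0 (e := ![s⁻¹, 0]) (f := ![0, s⁻¹])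
    (by simp [det2, hs])
  refine ⟨L, R, funext fun p => funext fun i => ?_⟩
  have hx : s * R p 0 = p 0 := by rw [hR]; simp; field_simp
  have hy : s * R p 1 = p 1 := by rw [hR]; simp; field_simp
  rw [Function.comp_apply, Function.comp_apply, hL]
  simp only [quadMap, normalMap, Matrix.cons_val, h1, h2]
  rw [← hx, ← hy]
  ring

/-- A quadratic mapping with three singular points is equivalent to `(x², y², (1 - x - y)²)`. -/
theorem exists_eq_normalMap {c : Fin 3 × Fin 6 → ℂ} (h : (crit (quadMap c)).encard = 3) :
    ∃ (L : (Fin 3 → ℂ) ≃ᵃ[ℂ] (Fin 3 → ℂ)) (R : (Fin 2 → ℂ) ≃ᵃ[ℂ] (Fin 2 → ℂ)),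
      quadMap c = L ∘ normalMap ∘ R := by
  obtain ⟨p, v, hp, hker, hdet⟩ := exists_kernels h
  have d12 := hdet 1 2 (by decide)
  have d02 := hdet 0 2 (by decide)
  have d10 := hdet 1 0 (by decide)
  -- The multiples of `v 1` and `v 2` given by Cramer's rule so that `v 0 = e - f`; in this frame
  -- the kernel directions are `(1, -1)`, `(1, 0)`, `(0, 1)`.
  set e : Fin 2 → ℂ := (det2 (v 0) (v 2) / det2 (v 1) (v 2)) • v 1 with he
  set f : Fin 2 → ℂ := (-det2 (v 1) (v 0) / det2 (v 1) (v 2)) • v 2 with hf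
  have hef : v 0 = e - f := by
    have key : ∀ i, det2 (v 1) (v 2) * v 0 i =
        det2 (v 0) (v 2) * v 1 i + det2 (v 1) (v 0) * v 2 i := by
      intro i
      fin_cases i <;> simp [det2] <;> ring
    ext i
    simp only [he, hf, Pi.sub_apply, Pi.smul_apply, smul_eq_mul]
    field_simp
    linear_combination key i
  have hdef : det2 e f ≠ 0 := by
    have : det2 e f = (det2 (v 0) (v 2) / det2 (v 1) (v 2)) *
        (-det2 (v 1) (v 0) / det2 (v 1) (v 2)) * det2 (v 1) (v 2) := by
      simp only [he, hf]
      generalize det2 (v 0) (v 2) / det2 (v 1) (v 2) = s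
      generalize -det2 (v 1) (v 0) / det2 (v 1) (v 2) = t
      simp [det2]
      ring
    rw [this]
    exact mul_ne_zero (mul_ne_zero (div_ne_zero d02 d12) (div_ne_zero (neg_ne_zero.2 d10) d12)) d12
  obtain ⟨R, hR⟩ := exists_affineEquiv_plane (p 0) hdef
  obtain ⟨c', hc'⟩ := exists_quadMap_comp c (p 0) e f
  have hcomp : quadMap c' = AffineEquiv.refl ℂ (Fin 3 → ℂ) ∘ quadMap c ∘ R := by
    funext x
    simp [hc', hR]
  have hD' : quadDet c' ≠ 0 := quadDet_ne_zero (by rw [hcomp, encard_crit_comp, h])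
  have hker' : ∀ x w : Fin 2 → ℂ, IsKer c (R x) (w 0 • e + w 1 • f) → IsKer c' x w := by
    intro x w hw
    rw [← quadMap_add_eq_sub_iff] at hw ⊢
    rw [hc', hc']
    convert hw using 2
    · rw [hR]
      simp only [Pi.add_apply]
      module
    · rw [hR]
      simp only [Pi.sub_apply]
      module
  have hR0 : R 0 = p 0 := by simp [hR]
  have h0 : IsKer c' 0 ![1, -1] := by
    refine hker' _ _ ?_
    rw [hR0]
    convert hker 0 using 1
    rw [hef]
    simp [sub_eq_add_neg]
  have h1 : IsKer c' (R.symm (p 1)) ![1, 0] := by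
    refine hker' _ _ ?_
    rw [AffineEquiv.apply_symm_apply]
    simpa [he] using (hker 1).smul _
  have h2 : IsKer c' (R.symm (p 2)) ![0, 1] := by
    refine hker' _ _ ?_
    rw [AffineEquiv.apply_symm_apply]
    simpa [hf] using (hker 2).smul _
  have hne : R.symm (p 1) ≠ 0 := by
    intro H
    have : p 1 = p 0 := by rw [← hR0, ← H, AffineEquiv.apply_symm_apply]
    exact absurd (hp this) (by decide)
  obtain ⟨L, R', hLR⟩ := exists_eq_normalMap_of_isKer hD' h0 h1 h2 hne
  refine ⟨L, R.symm.trans R', ?_⟩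
  funext x
  have := congrFun hLR (R.symm x)
  rw [hcomp] at this
  simpa using this

/-! ### Openness and density of nonvanishing sets -/

lemma pointToPoint_mem_basicOpen {σ : Type} (x : σ → ℂ) (g : MvPolynomial σ ℂ) :
    (pointToPoint x : PrimeSpectrum (MvPolynomial σ ℂ)) ∈ PrimeSpectrum.basicOpen g ↔
      eval x g ≠ 0 := by
  rw [PrimeSpectrum.mem_basicOpen]
  simp [pointToPoint]

lemma isOpen_zariski_ne_zero {σ : Type} (g : MvPolynomial σ ℂ) :
    IsOpen[zariskiAffine σ] {x : σ → ℂ | eval x g ≠ 0} := by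
  rw [isOpen_induced_iff]
  exact ⟨PrimeSpectrum.basicOpen g, (PrimeSpectrum.basicOpen g).2,
    Set.ext fun x => pointToPoint_mem_basicOpen x g⟩

/-- A neighbourhood of the image of a point contains a principal open set. -/
lemma exists_eval_ne_zero_of_isOpen {σ : Type} {S : Set (PrimeSpectrum (MvPolynomial σ ℂ))}
    (hS : IsOpen S) {x : σ → ℂ} (hx : pointToPoint x ∈ S) :
    ∃ g : MvPolynomial σ ℂ, eval x g ≠ 0 ∧ ∀ y : σ → ℂ, eval y g ≠ 0 → pointToPoint y ∈ S := by
  obtain ⟨_, ⟨g, rfl⟩, hxg, hgS⟩ :=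
    PrimeSpectrum.isTopologicalBasis_basic_opens.exists_subset_of_mem_open hx hS
  exact ⟨g, (pointToPoint_mem_basicOpen x g).1 hxg,
    fun y hy => hgS ((pointToPoint_mem_basicOpen y g).2 hy)⟩

lemma exists_eval_ne_zero {σ : Type} {g : MvPolynomial σ ℂ} (hg : g ≠ 0) :
    ∃ x, eval x g ≠ 0 := by
  by_contra! h
  exact hg (MvPolynomial.funext fun x => by rw [h x, map_zero])

lemma ne_zero_of_eval {σ : Type} {g : MvPolynomial σ ℂ} {x : σ → ℂ} (h : eval x g ≠ 0) :
    g ≠ 0 := by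
  rintro rfl
  exact h (map_zero _)

/-- The points of `Omega` at which a nonzero polynomial in the coefficients does not vanish form
an open dense set for the Zariski topology. -/
lemma isOpenDense_zariski {g : MvPolynomial (Fin 3 × Fin 6) ℂ} (hg : g ≠ 0) :
    IsOpenDense zariski {F : Omega | eval (coeffs F) g ≠ 0} := by
  constructor
  · exact (@isOpen_induced_iff _ _ (zariskiAffine _) _ coeffs).2
      ⟨_, isOpen_zariski_ne_zero g, rfl⟩
  · let := zariski
    rw [dense_iff_inter_open]
    rintro S hS ⟨F, hF⟩
    obtain ⟨S', hS', rfl⟩ := (@isOpen_induced_iff _ _ (zariskiAffine _) _ coeffs).1 hS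
    obtain ⟨S'', hS'', rfl⟩ := isOpen_induced_iff.1 hS'
    obtain ⟨h, hh, hsub⟩ := exists_eval_ne_zero_of_isOpen hS'' hF
    -- Density is the absence of zero divisors: a product of nonzero polynomials is nonzero
    -- somewhere on `ℂ¹⁸`.
    obtain ⟨y, hy⟩ := exists_eval_ne_zero (mul_ne_zero hg (ne_zero_of_eval hh))
    obtain ⟨G, rfl⟩ := coeffs_surjective y
    rw [map_mul] at hy
    exact ⟨G, hsub _ (right_ne_zero_of_mul hy), left_ne_zero_of_mul hy⟩

/-- The restriction of polynomials to the line through `x` with direction `v`. -/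
def lineHom {σ : Type} (x v : σ → ℂ) : MvPolynomial σ ℂ →ₐ[ℂ] Polynomial ℂ :=
  aeval fun i => Polynomial.C (x i) + Polynomial.X * Polynomial.C (v i)

lemma eval_lineHom {σ : Type} (x v : σ → ℂ) (g : MvPolynomial σ ℂ) (t : ℂ) :
    (lineHom x v g).eval t = eval (x + t • v) g := by
  rw [← Polynomial.coe_evalRingHom, lineHom, aeval_def, hom_eval₂, eval, coe_eval₂Hom]
  congr 1
  · ext
    simp
  · funext i
    rw [Polynomial.coe_evalRingHom, Polynomial.eval_add, Polynomial.eval_C,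
      Polynomial.eval_mul, Polynomial.eval_X, Polynomial.eval_C]
    rfl

/-- On the line joining `x` to a point where `g` does not vanish, `g` restricts to a nonzero
polynomial in one variable. Its zeros are finite in number, so `x` is a limit of points of
nonvanishing. -/
lemma dense_eval_ne_zero {σ : Type} {g : MvPolynomial σ ℂ} (hg : g ≠ 0) :
    Dense {x : σ → ℂ | eval x g ≠ 0} := by
  obtain ⟨y, hy⟩ := exists_eval_ne_zero hg
  intro x
  obtain ⟨q, hq⟩ : ∃ q : Polynomial ℂ, ∀ t, q.eval t = eval (x + t • (y - x)) g :=
    ⟨_, eval_lineHom x (y - x) g⟩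
  have hq0 : q ≠ 0 := by
    rintro rfl
    have := hq 1
    simp at this
    exact hy this.symm
  have hfin : {t : ℂ | q.eval t = 0}.Finite := by
    convert q.roots.toFinset.finite_toSet using 1
    ext t
    simp [hq0]
  have hd : (0 : ℂ) ∈ closure {t : ℂ | q.eval t = 0}ᶜ := hfin.countable.dense_compl ℂ 0
  have hc : Continuous fun t : ℂ => x + t • (y - x) := by fun_prop
  have := hc.continuousAt.continuousWithinAt.mem_closure_image hd
  simp only [zero_smul, add_zero] at this
  refine closure_mono ?_ this
  rintro _ ⟨t, ht, rfl⟩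
  change eval _ g ≠ 0
  rw [← hq]
  exact ht

lemma isOpenDense_euclidean {g : MvPolynomial (Fin 3 × Fin 6) ℂ} (hg : g ≠ 0) :
    IsOpenDense euclidean {F : Omega | eval (coeffs F) g ≠ 0} := by
  constructor
  · rw [isOpen_induced_iff]
    refine ⟨{x | eval x g ≠ 0}, ?_, rfl⟩
    exact isOpen_ne_fun (MvPolynomial.continuous_eval g) continuous_const
  · let := euclidean
    rw [dense_iff_inter_open]
    rintro S hS ⟨F, hF⟩
    obtain ⟨S', hS', rfl⟩ := isOpen_induced_iff.1 hS
    obtain ⟨y, hyS, hy⟩ := (dense_eval_ne_zero hg).inter_open_nonempty S' hS' ⟨_, hF⟩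
    obtain ⟨G, rfl⟩ := coeffs_surjective y
    exact ⟨G, hyS, hy⟩

/-! ### Krull dimension of a principal open subset of affine space -/

section Dimension

variable {T σ : Type} {φ : T → σ → ℂ} {g : MvPolynomial σ ℂ}

lemma topologicalKrullDim_le_of_isInducing [TopologicalSpace T] [Finite σ]
    (hφ : Topology.IsInducing fun x => (pointToPoint (φ x) : PrimeSpectrum (MvPolynomial σ ℂ))) :
    topologicalKrullDim T ≤ Nat.card σ := by
  refine hφ.topologicalKrullDim_le.trans ?_
  rw [PrimeSpectrum.topologicalKrullDim_eq_ringKrullDim,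
    MvPolynomial.ringKrullDim_of_isNoetherianRing, ringKrullDim_eq_zero_of_field, zero_add]

/-- Restriction of a polynomial to a coordinate subspace through `a`. -/
lemma exists_restrict (A : Set σ) [DecidablePred (· ∈ A)] (a : σ → ℂ) (f : MvPolynomial σ ℂ) :
    ∃ f' : MvPolynomial σ ℂ, ∀ y : σ → ℂ, eval y f' = eval (A.piecewise a y) f := by
  refine ⟨bind₁ (fun i => if i ∈ A then C (a i) else X i) f, fun y => ?_⟩
  rw [← coe_aeval_eq_eval, RingHom.coe_coe, aeval_bind₁, ← coe_aeval_eq_eval, RingHom.coe_coe]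
  congr 2
  funext i
  by_cases hi : i ∈ A <;> simp [hi]

variable (φ) in
/-- The points that agree with `a` in the coordinates in `A`. -/
def slice (A : Set σ) (a : T) : Set T := {x | ∀ i ∈ A, φ x i = φ a i}

lemma piecewise_eq_of_mem_slice {A : Set σ} [DecidablePred (· ∈ A)] {a x : T}
    (hx : x ∈ slice φ A a) : A.piecewise (φ a) (φ x) = φ x := by
  funext i
  by_cases hi : i ∈ A
  · simp [hi, hx i hi]
  · simp [hi]

/-- Two polynomials that do not vanish on a coordinate subspace have a common point of
nonvanishing in a slice. -/
lemma exists_mem_slice (hr : ∀ x, x ∈ Set.range φ ↔ eval x g ≠ 0) (A : Set σ)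
    [DecidablePred (· ∈ A)] (a : T) {f₁ f₂ : MvPolynomial σ ℂ} {y₁ y₂ : σ → ℂ}
    (h₁ : eval (A.piecewise (φ a) y₁) f₁ ≠ 0) (h₂ : eval (A.piecewise (φ a) y₂) f₂ ≠ 0) :
    ∃ x ∈ slice φ A a, eval (φ x) f₁ ≠ 0 ∧ eval (φ x) f₂ ≠ 0 := by
  obtain ⟨f₁', hf₁⟩ := exists_restrict A (φ a) f₁
  obtain ⟨f₂', hf₂⟩ := exists_restrict A (φ a) f₂
  obtain ⟨g', hg⟩ := exists_restrict A (φ a) g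
  rw [← hf₁] at h₁
  rw [← hf₂] at h₂
  have ha : eval (φ a) g' ≠ 0 := by
    rw [hg, piecewise_eq_of_mem_slice fun _ _ => rfl]
    exact (hr _).1 ⟨a, rfl⟩
  -- The factor `g'` keeps the point inside the range of `φ`; it is nonzero because `a` itself lies
  -- there.
  obtain ⟨y, hy⟩ := exists_eval_ne_zero
    (mul_ne_zero (mul_ne_zero (ne_zero_of_eval h₁) (ne_zero_of_eval h₂)) (ne_zero_of_eval ha))
  rw [map_mul, map_mul, hf₁, hf₂, hg] at hy
  obtain ⟨x, hx⟩ := (hr _).2 (right_ne_zero_of_mul hy)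
  refine ⟨x, fun i hi => by rw [hx]; simp [hi], ?_, ?_⟩
  · rw [hx]
    exact left_ne_zero_of_mul (left_ne_zero_of_mul hy)
  · rw [hx]
    exact right_ne_zero_of_mul (left_ne_zero_of_mul hy)

/-- A slice is a nonempty principal open subset of a coordinate subspace, in which any two nonempty
open sets meet. -/
lemma isIrreducible_slice [TopologicalSpace T]
    (hφ : Topology.IsInducing fun x => (pointToPoint (φ x) : PrimeSpectrum (MvPolynomial σ ℂ)))
    (hr : ∀ x, x ∈ Set.range φ ↔ eval x g ≠ 0) (A : Set σ) (a : T) :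
    IsIrreducible (slice φ A a) := by
  classical
  refine ⟨⟨a, fun _ _ => rfl⟩, ?_⟩
  rintro u v hu hv ⟨x, hx, hxu⟩ ⟨y, hy, hyv⟩
  obtain ⟨u', hu', rfl⟩ := hφ.isOpen_iff.1 hu
  obtain ⟨v', hv', rfl⟩ := hφ.isOpen_iff.1 hv
  obtain ⟨f₁, hf₁, hu₁⟩ := exists_eval_ne_zero_of_isOpen hu' hxu
  obtain ⟨f₂, hf₂, hv₂⟩ := exists_eval_ne_zero_of_isOpen hv' hyv
  rw [← piecewise_eq_of_mem_slice hx] at hf₁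
  rw [← piecewise_eq_of_mem_slice hy] at hf₂
  obtain ⟨z, hz, hz₁, hz₂⟩ := exists_mem_slice hr A a hf₁ hf₂
  exact ⟨z, hz, hu₁ _ hz₁, hv₂ _ hz₂⟩

lemma isClosed_slice [TopologicalSpace T]
    (hφ : Topology.IsInducing fun x => (pointToPoint (φ x) : PrimeSpectrum (MvPolynomial σ ℂ)))
    (A : Set σ) (a : T) : IsClosed (slice φ A a) := by
  have : slice φ A a = ⋂ i ∈ A, {x | φ x i = φ a i} := by
    ext x
    simp [slice]
  rw [this]
  refine isClosed_biInter fun i _ => ⟨hφ.isOpen_iff.2 ⟨PrimeSpectrum.basicOpen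
    (X i - C (φ a i)), (PrimeSpectrum.basicOpen _).2, ?_⟩⟩
  ext x
  simp only [Set.mem_preimage, SetLike.mem_coe, pointToPoint_mem_basicOpen]
  simp [sub_eq_zero]

lemma slice_ssubset (hr : ∀ x, x ∈ Set.range φ ↔ eval x g ≠ 0) {A B : Set σ} (hAB : A ⊂ B)
    (a : T) : slice φ B a ⊂ slice φ A a := by
  classical
  obtain ⟨i, hiB, hiA⟩ := Set.exists_of_ssubset hAB
  have hsub : slice φ B a ⊆ slice φ A a := fun x hx j hj => hx j (hAB.1 hj)
  refine (Set.ssubset_iff_of_subset hsub).2 ?_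
  obtain ⟨x, hx, hxi, -⟩ := exists_mem_slice hr A a (f₁ := X i - C (φ a i)) (f₂ := 1)
    (y₁ := fun _ => φ a i + 1) (y₂ := 0) (by simp [hiA]) (by simp)
  refine ⟨x, hx, fun hxB => hxi ?_⟩
  simp [hxB i hiB]

/-- A nonempty principal open subset of an affine space has the dimension of that space. -/
theorem topologicalKrullDim_eq_card [TopologicalSpace T] [Finite σ] [Nonempty T]
    (hφ : Topology.IsInducing fun x => (pointToPoint (φ x) : PrimeSpectrum (MvPolynomial σ ℂ)))
    (hr : ∀ x, x ∈ Set.range φ ↔ eval x g ≠ 0) :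
    topologicalKrullDim T = Nat.card σ := by
  refine le_antisymm (topologicalKrullDim_le_of_isInducing hφ) ?_
  obtain ⟨a⟩ := ‹Nonempty T›
  let e := Finite.equivFin σ
  -- The `k`-th term fixes all but the last `k` coordinates, so the chain grows from the point `a`
  -- to the whole space.
  let s : LTSeries (TopologicalSpace.IrreducibleCloseds T) := LTSeries.mk (Nat.card σ)
    (fun k => ⟨slice φ {i | (e i : ℕ) < Nat.card σ - k} a, isIrreducible_slice hφ hr _ a,
      isClosed_slice hφ _ a⟩) (by
    rw [Fin.strictMono_iff_lt_succ]
    intro k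
    refine SetLike.coe_ssubset_coe.1 (slice_ssubset hr ?_ a)
    refine (Set.ssubset_iff_of_subset fun i hi => ?_).2
      ⟨e.symm ⟨Nat.card σ - (k + 1), by omega⟩, ?_, ?_⟩
    · simp only [Set.mem_ofPred_eq, Fin.val_succ, Fin.val_castSucc] at hi ⊢
      omega
    · simp
      omega
    · simp)
  exact Order.LTSeries.length_le_krullDim s

end Dimension

/-! ### Scheme-theoretic fibres -/

lemma linearEquiv_apply_eq_sum {n : ℕ} (f : (Fin n → ℂ) ≃ₗ[ℂ] (Fin n → ℂ)) (x : Fin n → ℂ) :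
    f x = ∑ j, x j • f (Pi.single j 1) := by
  conv_lhs => rw [pi_eq_sum_univ' x]
  rw [map_sum]
  refine Finset.sum_congr rfl fun j _ => ?_
  rw [map_smul]

lemma linear_sub {n : ℕ} (f : (Fin n → ℂ) ≃ᵃ[ℂ] (Fin n → ℂ)) (x y : Fin n → ℂ) :
    f.linear (x - y) = f x - f y :=
  f.toAffineMap.linearMap_vsub x y

/-- The coordinates of an affine mapping of the plane are polynomials. -/
lemma exists_polynomial_affine (R : (Fin 2 → ℂ) ≃ᵃ[ℂ] (Fin 2 → ℂ)) (i : Fin 2) :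
    ∃ u : MvPolynomial (Fin 2) ℂ, ∀ p, eval p u = R p i := by
  refine ⟨C (R 0 i) + ∑ j, X j * C (R.linear (Pi.single j 1) i), fun p => ?_⟩
  have h1 : R p = R.linear p + R 0 := by simpa using R.map_vadd 0 p
  have h2 : R.linear p = ∑ j, p j • R.linear (Pi.single j 1) :=
    linearEquiv_apply_eq_sum _ _
  rw [h1, h2]
  simp [add_comm]

lemma eval_eq_zero_of_mem_fibreIdeal {F : Omega} {p q : Fin 2 → ℂ} (hq : toMap F q = toMap F p)
    {f : MvPolynomial (Fin 2) ℂ} (hf : f ∈ fibreIdeal F p) : eval q f = 0 := by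
  have h : fibreIdeal F p ≤ RingHom.ker (eval q) := by
    refine Ideal.span_le.2 ?_
    rintro _ ⟨i, rfl⟩
    have := congrFun hq i
    simp only [toMap] at this
    simp [RingHom.mem_ker, toMap, this]
  exact h hf

/-- The fibre through `p` is a simple point if and only if its ideal is the maximal ideal
of `p`. -/
lemma fibreIsSimplePoint_iff (F : Omega) (p : Fin 2 → ℂ) :
    FibreIsSimplePoint F p ↔ ∀ j, X j - C (p j) ∈ fibreIdeal F p := by
  constructor
  · intro h j
    obtain ⟨a, ha⟩ := h.2 (Ideal.Quotient.mk _ (X j))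
    have hmem : X j - C a ∈ fibreIdeal F p := Ideal.Quotient.eq.1 ha.symm
    -- Evaluating at `p` identifies the constant `a` as `p j`.
    have := eval_eq_zero_of_mem_fibreIdeal rfl hmem
    simp only [map_sub, eval_X, eval_C, sub_eq_zero] at this
    rwa [this]
  · intro h
    constructor
    · have : Nontrivial (MvPolynomial (Fin 2) ℂ ⧸ fibreIdeal F p) := by
        refine Ideal.Quotient.nontrivial_iff.2 fun htop => ?_
        have := eval_eq_zero_of_mem_fibreIdeal (F := F) (p := p) rfl
          (htop ▸ Submodule.mem_top : (1 : MvPolynomial (Fin 2) ℂ) ∈ _)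
        simp at this
      exact (algebraMap ℂ _).injective
    · intro y
      obtain ⟨f, rfl⟩ := Ideal.Quotient.mk_surjective y
      refine ⟨eval p f, ?_⟩
      have hhom : (algebraMap ℂ (MvPolynomial (Fin 2) ℂ ⧸ fibreIdeal F p)).comp (eval p) =
          Ideal.Quotient.mk (fibreIdeal F p) := by
        refine MvPolynomial.ringHom_ext (fun a => ?_) fun j => ?_
        · simp; rfl
        · simp only [RingHom.comp_apply, eval_X]
          exact (Ideal.Quotient.eq.2 (h j)).symm
      exact DFunLike.congr_fun hhom f

/-- If the restriction of `F` to a line through `p` factors through a quadratic polynomial, then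
the fibre through `p` is not a simple point. -/
lemma not_fibreIsSimplePoint {F : Omega} {p v : Fin 2 → ℂ} (hv : v ≠ 0) (k : ℂ)
    (w : Fin 3 → ℂ) (h : ∀ s : ℂ, toMap F (p + s • v) = toMap F p + (s * (s - k)) • w) :
    ¬ FibreIsSimplePoint F p := by
  rw [fibreIsSimplePoint_iff]
  intro hmem
  obtain ⟨j, hj⟩ := Function.ne_iff.1 hv
  -- Restriction to the line sends the ideal into `(X(X - k))`: two points if `k ≠ 0`, a double
  -- point if `k = 0`. In neither case does it contain a nonzero multiple of `X`.
  have hle : fibreIdeal F p ≤ (Ideal.span {Polynomial.X * (Polynomial.X - Polynomial.C k)}).comap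
      (lineHom p v : MvPolynomial (Fin 2) ℂ →+* Polynomial ℂ) := by
    refine Ideal.span_le.2 ?_
    rintro _ ⟨i, rfl⟩
    refine Ideal.mem_span_singleton.2 ⟨Polynomial.C (w i), Polynomial.funext fun t => ?_⟩
    have := congrFun (h t) i
    simp only [toMap, Pi.add_apply, Pi.smul_apply, smul_eq_mul] at this
    rw [RingHom.coe_coe, eval_lineHom]
    simp [this, toMap]
  obtain ⟨q, hq⟩ := Ideal.mem_span_singleton.1 (hle (hmem j))
  have hq' : Polynomial.C (v j) = (Polynomial.X - Polynomial.C k) * q := by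
    refine mul_left_cancel₀ Polynomial.X_ne_zero ?_
    rw [← mul_assoc, ← hq]
    simp [lineHom]
  have := congrArg (Polynomial.eval k) hq'
  simp at this
  exact hj this

/-! ### Degree and self-intersection curve of the normal form -/

/-- The barycentric coordinates of the triangle of singular points of `normalMap`. -/
def bary (q : Fin 2 → ℂ) : Fin 3 → ℂ := ![q 0, q 1, 1 - q 0 - q 1]

section NormalForm

variable {F : Omega} {L : (Fin 3 → ℂ) ≃ᵃ[ℂ] (Fin 3 → ℂ)} {R : (Fin 2 → ℂ) ≃ᵃ[ℂ] (Fin 2 → ℂ)}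

/-- Differences of the components of `normalMap` lie in the ideal of the fibre. -/
lemma mem_fibreIdeal_of_normalMap (h : toMap F = L ∘ normalMap ∘ R) (p : Fin 2 → ℂ) (j : Fin 3)
    {g : MvPolynomial (Fin 2) ℂ}
    (hg : ∀ x, eval x g = normalMap (R x) j - normalMap (R p) j) : g ∈ fibreIdeal F p := by
  have key : g = ∑ i, C (L.symm.linear (Pi.single i 1) j) * ((F i).1 - C (toMap F p i)) := by
    refine MvPolynomial.funext fun x => ?_
    have h1 : normalMap (R x) - normalMap (R p) = L.symm.linear (toMap F x - toMap F p) := by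
      rw [h]
      rw [linear_sub]
      simp
    have h2 : L.symm.linear (toMap F x - toMap F p) =
        ∑ i, (toMap F x - toMap F p) i • L.symm.linear (Pi.single i 1) :=
      linearEquiv_apply_eq_sum _ _
    rw [hg, ← Pi.sub_apply, h1, h2]
    simp [toMap, mul_comm]
  rw [key]
  exact Ideal.sum_mem _ fun i _ => Ideal.mul_mem_left _ _ (Ideal.subset_span ⟨i, rfl⟩)

/-- The excluded lines are where some barycentric coordinate is 1. Off them, the quadratic
generators yield two relations `m4`, `m5` linear in `u`, `v`, whose determinant is `a + b` up to a
nonzero constant, hence the maximal ideal of the point. -/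
lemma fibreIsSimplePoint_of_normalMap (h : toMap F = L ∘ normalMap ∘ R) {p : Fin 2 → ℂ}
    (h0 : R p 0 ≠ 1) (h1 : R p 1 ≠ 1) (h01 : R p 0 + R p 1 ≠ 0) : FibreIsSimplePoint F p := by
  obtain ⟨u, hu⟩ := exists_polynomial_affine R 0
  obtain ⟨v, hv⟩ := exists_polynomial_affine R 1
  set a := R p 0
  set b := R p 1
  have m0 : u ^ 2 - C (a ^ 2) ∈ fibreIdeal F p :=
    mem_fibreIdeal_of_normalMap h p 0 fun x => by simp [normalMap, hu, a]
  have m1 : v ^ 2 - C (b ^ 2) ∈ fibreIdeal F p :=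
    mem_fibreIdeal_of_normalMap h p 1 fun x => by simp [normalMap, hv, b]
  have m2 : (1 - u - v) ^ 2 - C ((1 - a - b) ^ 2) ∈ fibreIdeal F p :=
    mem_fibreIdeal_of_normalMap h p 2 fun x => by simp [normalMap, hu, hv, a, b]
  have C_two : (C 2 : MvPolynomial (Fin 2) ℂ) = 2 := map_ofNat C 2
  have hunit : ∀ (t : ℂ) (f : MvPolynomial (Fin 2) ℂ), t ≠ 0 → C t * f ∈ fibreIdeal F p →
      f ∈ fibreIdeal F p := by
    intro t f ht hf
    have : f = C t⁻¹ * (C t * f) := by rw [← mul_assoc, ← C_mul, inv_mul_cancel₀ ht, C_1, one_mul]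
    rw [this]
    exact Ideal.mul_mem_left _ _ hf
  -- From the identity `(1 - u - v)² - u² - v² = 2(1 - u)(1 - v) - 1`.
  have m3 : (1 - u) * (1 - v) - C ((1 - a) * (1 - b)) ∈ fibreIdeal F p := by
    refine hunit 2 _ two_ne_zero ?_
    convert sub_mem (sub_mem m2 m0) m1 using 1
    simp only [C_sub, C_mul, C_pow, C_1, C_two]
    ring
  have m4 : C (1 + a) * (1 - v) - C (1 - b) * (1 + u) ∈ fibreIdeal F p := by
    refine hunit (1 - a) _ (sub_ne_zero.2 h0.symm) ?_
    convert add_mem (Ideal.mul_mem_left _ (1 + u) m3) (Ideal.mul_mem_left _ (1 - v) m0) using 1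
    simp only [C_sub, C_mul, C_pow, C_1, C_add]
    ring
  have m5 : C (1 + b) * (1 - u) - C (1 - a) * (1 + v) ∈ fibreIdeal F p := by
    refine hunit (1 - b) _ (sub_ne_zero.2 h1.symm) ?_
    convert add_mem (Ideal.mul_mem_left _ (1 + v) m3) (Ideal.mul_mem_left _ (1 - u) m1) using 1
    simp only [C_sub, C_mul, C_pow, C_1, C_add]
    ring
  have m6 : u - C a ∈ fibreIdeal F p := by
    refine hunit (2 * (a + b)) _ (mul_ne_zero two_ne_zero h01) ?_
    convert sub_mem (Ideal.mul_mem_left _ (C (1 - a)) m4) (Ideal.mul_mem_left _ (C (1 + a)) m5)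
      using 1
    simp only [C_sub, C_mul, C_1, C_add, C_two]
    ring
  have m7 : v - C b ∈ fibreIdeal F p := by
    refine hunit (2 * (a + b)) _ (mul_ne_zero two_ne_zero h01) ?_
    convert sub_mem (Ideal.mul_mem_left _ (C (1 - b)) m5) (Ideal.mul_mem_left _ (C (1 + b)) m4)
      using 1
    simp only [C_sub, C_mul, C_1, C_add, C_two]
    ring
  rw [fibreIsSimplePoint_iff]
  intro j
  have key : X j - C (p j) = C (R.symm.linear (Pi.single 0 1) j) * (u - C a) +
      C (R.symm.linear (Pi.single 1 1) j) * (v - C b) := by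
    refine MvPolynomial.funext fun x => ?_
    have e1 : x - p = R.symm.linear (R x - R p) := by
      rw [linear_sub]
      simp
    have e2 : R.symm.linear (R x - R p) =
        ∑ i, (R x - R p) i • R.symm.linear (Pi.single i 1) :=
      linearEquiv_apply_eq_sum _ _
    have e3 := congrFun (e1.trans e2) j
    simp only [Fin.sum_univ_two, Pi.sub_apply, Pi.add_apply, Pi.smul_apply, smul_eq_mul] at e3
    simp only [map_sub, map_add, map_mul, eval_X, eval_C, hu, hv]
    linear_combination e3
  rw [key]
  exact add_mem (Ideal.mul_mem_left _ _ m6) (Ideal.mul_mem_left _ _ m7)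

/-- The direction of the line on which a barycentric coordinate is constant. -/
def baryDir : Fin 3 → Fin 2 → ℂ := ![![0, 1], ![1, 0], ![1, -1]]

lemma baryDir_ne_zero (i : Fin 3) : baryDir i ≠ 0 := by
  intro h
  have h0 := congrFun h 0
  have h1 := congrFun h 1
  fin_cases i <;> simp [baryDir] at h0 h1

/-- Where one barycentric coordinate is 1, the other two are opposite. Along this line their squares
agree and the third square is constant, so the mapping depends on a single quadratic polynomial. -/
lemma not_fibreIsSimplePoint_of_normalMap (h : toMap F = L ∘ normalMap ∘ R) {p : Fin 2 → ℂ}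
    {i : Fin 3} (hi : bary (R p) i = 1) : ¬ FibreIsSimplePoint F p := by
  obtain ⟨k, w, hkw⟩ : ∃ (k : ℂ) (w : Fin 3 → ℂ), ∀ s : ℂ,
      normalMap (R p + s • baryDir i) = normalMap (R p) + (s * (s - k)) • w := by
    fin_cases i
    · refine ⟨-2 * R p 1, ![0, 1, 1], fun s => ?_⟩
      have hi' : R p 0 = 1 := by simpa [bary] using hi
      ext j
      fin_cases j <;> simp [normalMap, baryDir, hi'] <;> ring
    · refine ⟨-2 * R p 0, ![1, 0, 1], fun s => ?_⟩
      have hi' : R p 1 = 1 := by simpa [bary] using hi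
      ext j
      fin_cases j <;> simp [normalMap, baryDir, hi'] <;> ring
    · refine ⟨-2 * R p 0, ![1, 1, 0], fun s => ?_⟩
      have hi' : R p 1 = -R p 0 := by
        simp [bary] at hi
        linear_combination -hi
      ext j
      fin_cases j <;> simp only [normalMap, baryDir, hi', Fin.mk_zero, Fin.mk_one,
        Fin.reduceFinMk, Matrix.cons_val, Pi.add_apply, Pi.smul_apply, smul_eq_mul] <;> ring
  refine not_fibreIsSimplePoint (v := R.symm.linear (baryDir i))
    (by simpa using baryDir_ne_zero i) k (L.linear w) fun s => ?_
  have h1 : R (p + s • R.symm.linear (baryDir i)) = R p + s • baryDir i := by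
    have := R.map_vadd p (s • R.symm.linear (baryDir i))
    simpa [add_comm] using this
  have h2 : L (normalMap (R p) + (s * (s - k)) • w) =
      L (normalMap (R p)) + (s * (s - k)) • L.linear w := by
    have := L.map_vadd (normalMap (R p)) ((s * (s - k)) • w)
    simpa [add_comm] using this
  rw [h]
  simp only [Function.comp_apply]
  rw [h1, hkw, h2]

lemma mem_SI_iff (h : toMap F = L ∘ normalMap ∘ R) (p : Fin 2 → ℂ) :
    p ∈ SI F ↔ ∃ i, bary (R p) i = 1 := by
  constructor
  · intro hp
    by_contra! hne
    refine hp (fibreIsSimplePoint_of_normalMap h (hne 0) (hne 1) fun h01 => hne 2 ?_)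
    simp only [bary, Matrix.cons_val]
    linear_combination -h01
  · rintro ⟨i, hi⟩
    exact not_fibreIsSimplePoint_of_normalMap h hi

theorem hasTopologicalDegree_one (h : toMap F = L ∘ normalMap ∘ R) :
    HasTopologicalDegree F 1 := by
  obtain ⟨u, hu⟩ := exists_polynomial_affine R 0
  obtain ⟨v, hv⟩ := exists_polynomial_affine R 1
  refine ⟨{x | eval x ((u - 1) * (v - 1) * (u + v)) ≠ 0}, isOpen_zariski_ne_zero _,
    ⟨R.symm ![2, 2], ?_⟩, fun x hx => ?_⟩
  · change eval _ _ ≠ 0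
    simp only [map_mul, map_sub, map_add, map_one, hu, hv, AffineEquiv.apply_symm_apply]
    norm_num
  · change eval _ _ ≠ 0 at hx
    simp only [map_mul, map_sub, map_add, map_one, hu, hv] at hx
    have hs := fibreIsSimplePoint_of_normalMap h
      (sub_ne_zero.1 (left_ne_zero_of_mul (left_ne_zero_of_mul hx)))
      (sub_ne_zero.1 (right_ne_zero_of_mul (left_ne_zero_of_mul hx))) (right_ne_zero_of_mul hx)
    rw [fibreIsSimplePoint_iff] at hs
    rw [Nat.cast_one, Set.encard_eq_one]
    refine ⟨x, Set.Subset.antisymm (fun q hq => ?_) (by simp)⟩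
    ext j
    have := eval_eq_zero_of_mem_fibreIdeal hq (hs j)
    simpa [sub_eq_zero] using this

lemma existsUnique_bary {i j : Fin 3} (hij : i ≠ j) :
    ∃! q : Fin 2 → ℂ, bary q i = 1 ∧ bary q j = 1 := by
  have huniq : ∀ q q' : Fin 2 → ℂ, bary q i = 1 ∧ bary q j = 1 → bary q' i = 1 ∧ bary q' j = 1 →
      q' = q := by
    rintro q q' ⟨h1, h2⟩ ⟨h3, h4⟩
    have : q' 0 = q 0 ∧ q' 1 = q 1 := by
      fin_cases i <;> fin_cases j <;> simp [bary] at hij h1 h2 h3 h4 <;> constructor <;> grind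
    ext k
    fin_cases k
    exacts [this.1, this.2]
  have hex : ∃ q : Fin 2 → ℂ, bary q i = 1 ∧ bary q j = 1 := by
    fin_cases i <;> fin_cases j <;> first
      | exact absurd rfl hij
      -- The intersection points have barycentric coordinates 1, 1, -1 in some order.
      | (refine ⟨![1, 1], ?_⟩; norm_num [bary]; done)
      | (refine ⟨![1, -1], ?_⟩; norm_num [bary]; done)
      | (refine ⟨![-1, 1], ?_⟩; norm_num [bary])
  obtain ⟨q, hq⟩ := hex
  exact ⟨q, hq, fun q' hq' => huniq q q' hq hq'⟩

/-- The points at which the barycentric coordinates are equal to one. -/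
def baryPoint : Fin 3 → Fin 2 → ℂ := ![![1, 0], ![0, 1], ![0, 0]]

lemma bary_eq_one_iff (i : Fin 3) (q : Fin 2 → ℂ) :
    bary q i = 1 ↔ ∃ t : ℂ, t • baryDir i = q - baryPoint i := by
  constructor
  · intro h
    fin_cases i
    · refine ⟨q 1, ?_⟩
      ext k
      fin_cases k <;> simp_all [bary, baryDir, baryPoint]
    · refine ⟨q 0, ?_⟩
      ext k
      fin_cases k <;> simp_all [bary, baryDir, baryPoint]
    · refine ⟨q 0, ?_⟩
      simp [bary] at h
      ext k
      fin_cases k <;> simp [baryDir, baryPoint]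
      linear_combination h
  · rintro ⟨t, ht⟩
    have h0 := congrFun ht 0
    have h1 := congrFun ht 1
    fin_cases i <;> simp [bary, baryDir, baryPoint] at h0 h1 ⊢
    · linear_combination -h0
    · linear_combination -h1
    · linear_combination h0 + h1

theorem isThreeLinesInGeneralPosition_SI (h : toMap F = L ∘ normalMap ∘ R) :
    IsThreeLinesInGeneralPosition (SI F) := by
  let l : Fin 3 → AffineSubspace ℂ (Fin 2 → ℂ) := fun i =>
    AffineSubspace.mk' (R.symm (baryPoint i)) (Submodule.span ℂ {R.symm.linear (baryDir i)})
  have hmem : ∀ i p, p ∈ l i ↔ bary (R p) i = 1 := by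
    intro i p
    rw [AffineSubspace.mem_mk', Submodule.mem_span_singleton, bary_eq_one_iff]
    refine exists_congr fun t => ?_
    have h1 : R.symm.linear (R p - baryPoint i) = p - R.symm (baryPoint i) := by
      rw [linear_sub]
      simp
    rw [vsub_eq_sub, ← h1, ← map_smul]
    exact R.symm.linear.injective.eq_iff
  refine ⟨l, fun i => ⟨⟨_, AffineSubspace.self_mem_mk' _ _⟩, ?_⟩, ?_, fun i j hij => ?_, ?_⟩
  · rw [AffineSubspace.direction_mk']
    exact finrank_span_singleton (by simpa using baryDir_ne_zero i)
  · ext p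
    rw [mem_SI_iff h, Set.mem_iUnion]
    exact exists_congr fun i => (hmem i p).symm
  · obtain ⟨q, hq, huniq⟩ := existsUnique_bary hij
    refine ⟨R.symm q, by simpa [hmem] using hq, fun p hp => ?_⟩
    simp only [hmem] at hp
    rw [← huniq _ hp, AffineEquiv.symm_apply_apply]
  · rintro ⟨p, hp⟩
    simp only [hmem] at hp
    have h0 := hp 0
    have h1 := hp 1
    have h2 := hp 2
    simp only [bary, Matrix.cons_val] at h0 h1 h2
    norm_num [h0, h1] at h2

end NormalForm

/-! ### The orbit of `F₁` -/

lemma encard_criticalSet_eq_three_iff (F : Omega) :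
    (criticalSet F).encard = 3 ↔ orbitDisc (coeffs F) ≠ 0 := by
  rw [criticalSet_eq_crit, toMap_eq_quadMap, encard_crit_eq_three_iff]

lemma exists_toMap_eq_normalMap {F : Omega} (h : (criticalSet F).encard = 3) :
    ∃ (L : (Fin 3 → ℂ) ≃ᵃ[ℂ] (Fin 3 → ℂ)) (R : (Fin 2 → ℂ) ≃ᵃ[ℂ] (Fin 2 → ℂ)),
      toMap F = L ∘ normalMap ∘ R := by
  rw [criticalSet_eq_crit, toMap_eq_quadMap] at h
  rw [toMap_eq_quadMap]
  exact exists_eq_normalMap h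

/-- Here the quadratic determinant is -1 and the cubic form is `-(v₀³ + v₁³)`, with discriminant
-27. -/
lemma encard_criticalSet_F₁ : (criticalSet F₁).encard = 3 := by
  have hmap : toMap F₁ = quadMap (fun k => (![![0, 0, 1, 1, 0, 0], ![0, 1, 0, 0, 0, 1],
      ![0, 0, 0, 0, 1, 0]] : Fin 3 → Fin 6 → ℂ) k.1 k.2) := by
    funext p i
    fin_cases i <;> simp [toMap, F₁, quadMap] <;> ring
  rw [criticalSet_eq_crit, hmap, encard_crit_eq_three_iff]
  simp [orbitDisc, quadDet, cubicDisc, cubicCoeff, det3, col]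

lemma mem_orbit_F₁_iff (F : Omega) : F ∈ orbit F₁ ↔ (criticalSet F).encard = 3 := by
  constructor
  · rintro ⟨L, R, h⟩
    rw [criticalSet_eq_crit, h, encard_crit_comp, ← criticalSet_eq_crit, encard_criticalSet_F₁]
  · intro h
    obtain ⟨L, R, hF⟩ := exists_toMap_eq_normalMap h
    obtain ⟨L₁, R₁, hF₁⟩ := exists_toMap_eq_normalMap encard_criticalSet_F₁
    refine ⟨L₁.symm.trans L, R.trans R₁.symm, ?_⟩
    rw [hF, hF₁]
    funext p
    simp

/-- The polynomial in the coefficients whose nonvanishing defines the orbit of `F₁`. -/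
def orbitDiscPoly : MvPolynomial (Fin 3 × Fin 6) ℂ := orbitDisc X

/-- The invariants are defined over any commutative ring, so that the same formula serves for
numbers and for the indeterminates. -/
lemma eval_orbitDiscPoly (c : Fin 3 × Fin 6 → ℂ) : eval c orbitDiscPoly = orbitDisc c := by
  simp [orbitDiscPoly, orbitDisc, quadDet, cubicDisc, cubicCoeff, det3, col]

lemma orbit_F₁_eq : orbit F₁ = {F | eval (coeffs F) orbitDiscPoly ≠ 0} := by
  ext F
  rw [mem_orbit_F₁_iff, encard_criticalSet_eq_three_iff, ← eval_orbitDiscPoly]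
  rfl

lemma orbitDiscPoly_ne_zero : orbitDiscPoly ≠ 0 := by
  have h := mem_orbit_self F₁
  rw [orbit_F₁_eq] at h
  exact ne_zero_of_eval h

lemma isOpenDense_zariski_orbit_F₁ : IsOpenDense zariski (orbit F₁) := by
  rw [orbit_F₁_eq]
  exact isOpenDense_zariski orbitDiscPoly_ne_zero

lemma isOpenDense_euclidean_orbit_F₁ : IsOpenDense euclidean (orbit F₁) := by
  rw [orbit_F₁_eq]
  exact isOpenDense_euclidean orbitDiscPoly_ne_zero

/-- Two orbits that are open and dense for the same topology coincide. -/
lemma mem_orbit_of_isOpenDense {t : TopologicalSpace Omega} {F G : Omega}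
    (hF : IsOpenDense t (orbit F)) (hG : IsOpenDense t (orbit G)) : F ∈ orbit G := by
  obtain ⟨H, hH, hH'⟩ := hF.2.inter_open_nonempty _ hG.1 ⟨G, mem_orbit_self G⟩
  exact mem_orbit_trans (mem_orbit_symm hH') hH

lemma dim_orbit_F₁ : dim (orbit F₁) = 18 := by
  let : TopologicalSpace (orbit F₁) := TopologicalSpace.induced Subtype.val zariski
  have : Nonempty (orbit F₁) := ⟨⟨F₁, mem_orbit_self F₁⟩⟩
  have h := topologicalKrullDim_eq_card (T := orbit F₁) (φ := fun F => coeffs F.1)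
    (g := orbitDiscPoly) ⟨by
      change TopologicalSpace.induced _ (TopologicalSpace.induced _
        (TopologicalSpace.induced _ _)) = _
      rw [induced_compose, induced_compose]
      rfl⟩ (fun x => by
      obtain ⟨G, rfl⟩ := coeffs_surjective x
      have hG : G ∈ orbit F₁ ↔ eval (coeffs G) orbitDiscPoly ≠ 0 := by
        rw [orbit_F₁_eq]
        rfl
      rw [← hG]
      constructor
      · rintro ⟨F, hF⟩
        exact coeffs_injective hF ▸ F.2
      · exact fun hG => ⟨⟨G, hG⟩, rfl⟩)
  rw [dim, h]
  simp

end QuadMaps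

end

theorem mainTheorem3 (F : QuadMaps.Omega) :
    List.TFAE
      [(QuadMaps.criticalSet F).encard = 3,
       QuadMaps.IsOpenDense QuadMaps.zariski (QuadMaps.orbit F),
       QuadMaps.IsOpenDense QuadMaps.euclidean (QuadMaps.orbit F),
       QuadMaps.orbit F = QuadMaps.orbit QuadMaps.F₁,
       QuadMaps.LinearlyEquivalent F QuadMaps.F₁] ∧
    ((QuadMaps.criticalSet F).encard = 3 →
      QuadMaps.HasTopologicalDegree F 1 ∧
      QuadMaps.IsThreeLinesInGeneralPosition (QuadMaps.SI F) ∧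
      QuadMaps.dim (QuadMaps.orbit F) = 18) := by
  constructor
  · tfae_have 1 ↔ 5 := (QuadMaps.mem_orbit_F₁_iff F).symm
    tfae_have 5 → 4 := QuadMaps.orbit_eq_of_mem
    tfae_have 4 → 2 := fun h => h ▸ QuadMaps.isOpenDense_zariski_orbit_F₁
    tfae_have 4 → 3 := fun h => h ▸ QuadMaps.isOpenDense_euclidean_orbit_F₁
    tfae_have 2 → 5 := fun h =>
      QuadMaps.mem_orbit_of_isOpenDense h QuadMaps.isOpenDense_zariski_orbit_F₁
    tfae_have 3 → 5 := fun h =>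
      QuadMaps.mem_orbit_of_isOpenDense h QuadMaps.isOpenDense_euclidean_orbit_F₁
    tfae_finish
  · intro h
    obtain ⟨L, R, hF⟩ := QuadMaps.exists_toMap_eq_normalMap h
    refine ⟨QuadMaps.hasTopologicalDegree_one hF,
      QuadMaps.isThreeLinesInGeneralPosition_SI hF, ?_⟩
    rw [QuadMaps.orbit_eq_of_mem ((QuadMaps.mem_orbit_F₁_iff F).2 h), QuadMaps.dim_orbit_F₁]
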